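/- Let $d\ge 1$, let $\mathcal S_d=\{x\in[0,1]^d:\sum_{i=1}^d x_i\le 1\}$, and let $f$ be a probability density supported on $\mathcal S_d$ which is $C^2$ on the interior of $\mathcal S_d$ and whose restriction to $\mathcal S_d$ extends to a $C^2$ function on an open neighbourhood of $\mathcal S_d$. Let $X_1,\dots,X_n$ be independent observations with density $f$, and for $m\ge1$ and $x\in\mathcal S_d$ let $$\widetilde f_{n,m}(x)=\sum_{k\in\mathbb N_0^d,\ k_1+\dots+k_d\le m-1} m^d\Big\{\frac1n\sum_{j=1}^n \mathbf 1_{(\frac km,\frac{k+1}m]}(X_j)\Big\}P_{k,m-1}(x),$$ where $(\frac km,\frac{k+1}m]=\prod_{i=1}^d(\frac{k_i}m,\frac{k_i+1}m]$ and $$P_{k,N}(x)=\frac{N!}{(N-\sum_i k_i)!\prod_i k_i!}\Big(1-\sum_i x_i\Big)^{N-\sum_i k_i}\prod_i x_i^{k_i}.$$ Let $J\subseteq[d]=\{1,\dots,d\}$. For $A\subseteq [d]$ put $x_A=(x_i)_{i\in A}$ and $\psi_A(x)=\big[(4\pi)^{|A|}(1-\sum_{i\in A}x_i)\prod_{i\in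 A}x_i\big]^{-1/2}$, and let $I_0(z)=\sum_{k\ge0}(z/2)^{2k}/(k!)^2$. Then for every $x\in\mathcal S_d$ such that $x_i=\lambda_i/m$ for all $i\in J$ (with fixed $\lambda_i\ge0$), $x_i\in(0,1)$ is independent of $m$ for all $i\in[d]\setminus J$, and $\sum_{i\in[d]\setminus J}x_i<1$, we have, as $n\to\infty$ with $m=m(n)\to\infty$, $$\mathrm{Var}\big(\widetilde f_{n,m}(x)\big)=n^{-1}m^{(d+|J|)/2}\Big\{f(x)\big|_{x_J=0}\,\psi_{[d]\setminus J}(x)\prod_{i\in J}e^{-2\lambda_i}I_0(2\lambda_i)+O_{\lambda_J}(m^{-1})+o_{x_{[d]\setminus J}}(1)\,\mathbf 1_{\{J\ne[d]\}}\Big\}.$$ Here, apart from $f$, $d$ and $J$, the constant in the $O$ term depends only on $\lambda_J$ and the rate of convergence to zero of the $o$ term depends only on $x_{[d]\setminus J}$. That is, there are $C(\lambda_J)$ and $r(x_{[d]\setminus J},m)$, with $r(x_{[d]\setminus J},m)\to0$ as $m\to\infty$, such that for all $n,m\ge1$ and all such $x$ and $\lambda_J$ the two error terms are at most $C(\lambda_J)\,m^{-1}$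 and $r(x_{[d]\setminus J},m)$ in absolute value. -/

import Mathlib

noncomputable section

namespace BernsteinSimplex

/-- The unit simplex in dimension `d`: points of `[0,1]^d` with `ℓ¹` norm at most one. -/
def simplex (d : ℕ) : Set (Fin d → ℝ) :=
  {x | (∀ i, x i ∈ Set.Icc (0 : ℝ) 1) ∧ ∑ i, |x i| ≤ 1}

/-- The interior of the unit simplex. -/
def simplexInterior (d : ℕ) : Set (Fin d → ℝ) :=
  {x | (∀ i, x i ∈ Set.Ioo (0 : ℝ) 1) ∧ ∑ i, |x i| < 1}

/-- The multi-indices `k ∈ ℕ₀^d ∩ N • simplex d`, i.e. those with `k₁ + ⋯ + k_d ≤ N`. -/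
def indexSet (d N : ℕ) : Finset (Fin d → ℕ) :=
  (Fintype.piFinset fun _ : Fin d => Finset.range (N + 1)).filter fun k => ∑ i, k i ≤ N

/-- The multinomial probability `P_{k,N}(x)` (meant for `k ∈ indexSet d N`). -/
def multinomialProb {d : ℕ} (k : Fin d → ℕ) (N : ℕ) (x : Fin d → ℝ) : ℝ :=
  (N.factorial : ℝ) / (((N - ∑ i, k i).factorial : ℝ) * ∏ i, ((k i).factorial : ℝ))
    * (1 - ∑ i, |x i|) ^ (N - ∑ i, k i) * ∏ i, x i ^ k i

/-- The half-open hypercube `(k/m, (k+1)/m]`, a product of half-open intervals. -/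
def cell {d : ℕ} (m : ℕ) (k : Fin d → ℕ) : Set (Fin d → ℝ) :=
  Set.univ.pi fun i => Set.Ioc ((k i : ℝ) / m) (((k i : ℝ) + 1) / m)

/-- The Bernstein density estimator of order `m` at `x`, from the observations
`X 0, …, X (n-1)`. -/
def densityEstimator {d n : ℕ} (m : ℕ) (X : Fin n → Fin d → ℝ) (x : Fin d → ℝ) : ℝ :=
  ∑ k ∈ indexSet d (m - 1),
    (m : ℝ) ^ d * ((1 / (n : ℝ)) * ∑ j : Fin n, (cell m k).indicator (fun _ => (1 : ℝ)) (X j))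
      * multinomialProb k (m - 1) x

/-- The modified Bessel function of the first kind, of integer order `ν`. -/
def besselI (ν : ℕ) (z : ℝ) : ℝ :=
  ∑' k : ℕ, (z / 2) ^ (2 * k + ν) / ((k.factorial : ℝ) * ((k + ν).factorial : ℝ))

/-- `ψ_A(x) = [(4π)^{|A|} (1 - ∑_{i ∈ A} x_i) ∏_{i ∈ A} x_i]^{-1/2}`. -/
def psi {d : ℕ} (A : Finset (Fin d)) (x : Fin d → ℝ) : ℝ :=
  ((4 * Real.pi) ^ A.card * (1 - ∑ i ∈ A, x i) * ∏ i ∈ A, x i) ^ (-(1 / 2) : ℝ)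

/-- The point `x` with its coordinates in `J` replaced by zero. -/
def zeroOn {d : ℕ} (J : Finset (Fin d)) (x : Fin d → ℝ) : Fin d → ℝ :=
  fun i => if i ∈ J then 0 else x i

/-- `f` is a probability density (with respect to Lebesgue measure) supported on the simplex. -/
structure IsSimplexDensity {d : ℕ} (f : (Fin d → ℝ) → ℝ) : Prop where
  measurable : Measurable f
  nonneg : ∀ y, 0 ≤ f y
  eq_zero : ∀ y, y ∉ simplex d → f y = 0
  lintegral_eq_one : ∫⁻ y, ENNReal.ofReal (f y) = 1

/-- `f` is `C²` on the interior of the simplex, and its restriction to the closed simplex extends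
to a `C²` function on an open neighbourhood of the simplex. -/
def IsC2OnSimplex {d : ℕ} (f : (Fin d → ℝ) → ℝ) : Prop :=
  ContDiffOn ℝ 2 f (simplexInterior d) ∧
    ∃ (U : Set (Fin d → ℝ)) (g : (Fin d → ℝ) → ℝ), IsOpen U ∧ simplex d ⊆ U ∧
      Set.EqOn g f (simplex d) ∧ ContDiffOn ℝ 2 g U

end BernsteinSimplex

end

/-! The estimator is the mean of `n` independent copies of a step function of one observation, and
the cells are disjoint. Hence its variance is exactly `n⁻¹ m^(2d) (∑ p_k P_k² - (∑ p_k P_k)²)`,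
where `p_k` is the mass of the cell at `k` (`variance_densityEstimator`). Since `m^d p_k` is an
average of `f` over a cell of side `1/m`, `f` is Lipschitz on the simplex, and `P_k` concentrates at
`k/m ≈ x`, one may replace `m^d p_k` by `f` at the point `x` with `x_J = 0`. The squared mean is of
lower order. What remains is the collision probability `∑ P_k²` of two independent multinomial
vectors.

By Parseval (`sum_multinomialProb_sq`) this is the torus average of `|φ|^(2(m-1))`, with `φ(t) = 1 +
∑ x_i (e^{i t_i} - 1)`. Write `φ = φ_y - w`, where `φ_y` involves the coordinates outside `J` and
`w` those in `J`. Since `w = O(1/m)`, `|φ|^(2(m-1))` is close to `|φ_y|^(2(m-1)) exp(-2 m Re w)`,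
and `m Re w = ∑_J λ_i (1 - cos t_i)` does not depend on `m`. The two factors depend on different
coordinates, so the integral splits (`exists_abs_rpow_mul_sum_sq_sub_le`). The first factor lives at
the scale `t ~ 1/√m` and gives the Gaussian constant `ψ` (`tendsto_rpow_mul_integral_stepChar`). The
second is a product of squared Poisson characteristic functions and gives `∏ e^{-2λ} I₀(2λ)`.

For uniformity, the error is at most a constant `K` depending on `x` outside `J`, times powers of `T
= 1 + ∑ λ` over `m` or `√m`, plus `K` times the error in the Gaussian limit. Weighted AM-GM
separates `K` from `T` (`mul_add_div_sqrt_le`). If `∑_J x_i` is not small, then `m` is at most a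
multiple of `T`, and a crude bound suffices. -/

namespace BernsteinSimplex

open MeasureTheory ProbabilityTheory Filter Topology

/-! ### The multinomial theorem -/

/-- The multinomial coefficient `N! / ((N - ∑ k)! ∏ k!)` as a natural number. -/
def multinomialCoeff {d : ℕ} (k : Fin d → ℕ) (N : ℕ) : ℕ :=
  N.choose (∑ i, k i) * Nat.multinomial Finset.univ k

lemma mem_indexSet {d N : ℕ} {k : Fin d → ℕ} : k ∈ indexSet d N ↔ ∑ i, k i ≤ N := by
  simp only [indexSet, Finset.mem_filter, Fintype.mem_piFinset, Finset.mem_range,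
    and_iff_right_iff_imp]
  intro h i
  have := Finset.single_le_sum (f := k) (fun _ _ => Nat.zero_le _) (Finset.mem_univ i)
  omega

lemma multinomialCoeff_eq {d N : ℕ} {k : Fin d → ℕ} (hk : ∑ i, k i ≤ N) :
    (multinomialCoeff k N : ℝ)
      = (N.factorial : ℝ) / (((N - ∑ i, k i).factorial : ℝ) * ∏ i, ((k i).factorial : ℝ)) := by
  have h1 := Nat.choose_mul_factorial_mul_factorial hk
  have h2 := Nat.multinomial_spec Finset.univ k
  have h3 : (∏ i, ((k i).factorial : ℝ)) ≠ 0 :=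
    Finset.prod_ne_zero_iff.2 fun i _ => by exact_mod_cast (k i).factorial_ne_zero
  have h4 : ((N - ∑ i, k i).factorial : ℝ) ≠ 0 := by
    exact_mod_cast (N - ∑ i, k i).factorial_ne_zero
  rw [eq_div_iff (mul_ne_zero h4 h3), multinomialCoeff, ← h1, ← h2]
  push_cast
  ring

lemma multinomialProb_eq {d N : ℕ} {k : Fin d → ℕ} {x : Fin d → ℝ} (hk : ∑ i, k i ≤ N)
    (hx : ∀ i, 0 ≤ x i) :
    multinomialProb k N x
      = multinomialCoeff k N * (1 - ∑ i, x i) ^ (N - ∑ i, k i) * ∏ i, x i ^ k i := by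
  rw [multinomialProb, multinomialCoeff_eq hk]
  simp only [abs_of_nonneg (hx _)]

theorem sum_multinomialCoeff_mul_pow {R : Type*} [CommSemiring R] {d N : ℕ} (a : R)
    (b : Fin d → R) :
    ∑ k ∈ indexSet d N, (multinomialCoeff k N : R) * a ^ (N - ∑ i, k i) * ∏ i, b i ^ k i
      = (a + ∑ i, b i) ^ N := by
  rw [← Finset.sum_fiberwise_of_maps_to (s := indexSet d N) (t := Finset.range (N + 1))
    (g := fun k => ∑ i, k i) (fun k hk => Finset.mem_range_succ_iff.2 (mem_indexSet.1 hk)),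
    add_comm a, add_pow]
  refine Finset.sum_congr rfl fun j hj => ?_
  rw [Finset.sum_pow_eq_sum_piAntidiag, Finset.sum_mul, Finset.sum_mul]
  have hj' := Finset.mem_range_succ_iff.1 hj
  refine Finset.sum_congr ?_ fun k hk => ?_
  · ext k
    simp only [Finset.mem_filter, mem_indexSet, Finset.mem_piAntidiag, Finset.mem_univ,
      implies_true, and_true]
    constructor
    · exact fun h => h.2
    · intro h
      exact ⟨by rw [h]; exact hj', h⟩
  · have hk' : ∑ i, k i = j := (Finset.mem_piAntidiag.1 hk).1
    rw [multinomialCoeff, hk']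
    push_cast
    ring

/-! ### Moments of the multinomial distribution -/

section Moments

variable {d N : ℕ} {x : Fin d → ℝ}

lemma multinomialProb_nonneg {k : Fin d → ℕ} (hx : ∀ i, 0 ≤ x i) (hs : ∑ i, x i ≤ 1)
    (hk : k ∈ indexSet d N) : 0 ≤ multinomialProb k N x := by
  rw [multinomialProb_eq (mem_indexSet.1 hk) hx]
  have : 0 ≤ 1 - ∑ i, x i := by linarith
  have := Finset.prod_nonneg (s := Finset.univ) fun i _ => pow_nonneg (hx i) (k i)
  positivity

/-- Weighting only the `j`-th variable in the multinomial theorem collapses the generating function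
to that of a binomial law with parameters `N` and `x j`. Its derivatives in `s` at `1` are the
factorial moments used below. -/
lemma sum_multinomialProb_mul_pow (hx : ∀ i, 0 ≤ x i) (j : Fin d) (s : ℝ) :
    ∑ k ∈ indexSet d N, multinomialProb k N x * s ^ k j = (1 + x j * (s - 1)) ^ N := by
  have h := sum_multinomialCoeff_mul_pow (N := N) (1 - ∑ i, x i)
    (fun i => x i * if i = j then s else 1)
  have h2 : (1 - ∑ i, x i) + ∑ i, (x i * if i = j then s else 1) = 1 + x j * (s - 1) := by
    have : ∀ i, (x i * if i = j then s else 1) = x i + if i = j then x i * (s - 1) else 0 := by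
      intro i; split_ifs <;> ring
    simp only [this, Finset.sum_add_distrib, Finset.sum_ite_eq', Finset.mem_univ, if_true]
    ring
  rw [h2] at h
  rw [← h]
  refine Finset.sum_congr rfl fun k hk => ?_
  rw [multinomialProb_eq (mem_indexSet.1 hk) hx]
  have h3 : ∏ i, (if i = j then s else 1) ^ k i = s ^ k j := by
    rw [Finset.prod_eq_single j]
    · simp
    · intro i _ hi; simp [hi]
    · simp
  simp only [mul_pow, Finset.prod_mul_distrib, h3]
  ring

lemma sum_multinomialProb (hx : ∀ i, 0 ≤ x i) :
    ∑ k ∈ indexSet d N, multinomialProb k N x = 1 := by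
  have h := sum_multinomialCoeff_mul_pow (N := N) (1 - ∑ i, x i) x
  rw [sub_add_cancel, one_pow] at h
  rw [← h]
  exact Finset.sum_congr rfl fun k hk => multinomialProb_eq (mem_indexSet.1 hk) hx

lemma multinomialProb_le_one {k : Fin d → ℕ} (hx : ∀ i, 0 ≤ x i) (hs : ∑ i, x i ≤ 1)
    (hk : k ∈ indexSet d N) : multinomialProb k N x ≤ 1 := by
  rw [← sum_multinomialProb (N := N) hx]
  exact Finset.single_le_sum (f := fun k => multinomialProb k N x)
    (fun k hk => multinomialProb_nonneg hx hs hk) hk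

lemma sum_multinomialProb_mul_pred_pow (hx : ∀ i, 0 ≤ x i) (j : Fin d) (s : ℝ) :
    ∑ k ∈ indexSet d N, multinomialProb k N x * (k j * s ^ (k j - 1))
      = N * (1 + x j * (s - 1)) ^ (N - 1) * x j := by
  have h1 : HasDerivAt (fun s : ℝ => ∑ k ∈ indexSet d N, multinomialProb k N x * s ^ k j)
      (∑ k ∈ indexSet d N, multinomialProb k N x * (k j * s ^ (k j - 1))) s :=
    HasDerivAt.fun_sum fun k _ => (hasDerivAt_pow (k j) s).const_mul _
  have h2 : HasDerivAt (fun s : ℝ => (1 + x j * (s - 1)) ^ N)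
      (N * (1 + x j * (s - 1)) ^ (N - 1) * x j) s := by
    have h3 : HasDerivAt (fun s : ℝ => 1 + x j * (s - 1)) (x j) s := by
      simpa using (((hasDerivAt_id s).sub_const 1).const_mul (x j)).const_add 1
    exact h3.fun_pow N
  refine h1.unique ?_
  simpa only [sum_multinomialProb_mul_pow hx j] using h2

lemma sum_multinomialProb_mul (hx : ∀ i, 0 ≤ x i) (j : Fin d) :
    ∑ k ∈ indexSet d N, multinomialProb k N x * k j = N * x j := by
  simpa using sum_multinomialProb_mul_pred_pow (N := N) hx j 1

lemma sum_multinomialProb_mul_mul_sub_one (hx : ∀ i, 0 ≤ x i) (j : Fin d) :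
    ∑ k ∈ indexSet d N, multinomialProb k N x * (k j * (k j - 1))
      = N * (N - 1) * x j ^ 2 := by
  have h1 : HasDerivAt (fun s : ℝ =>
      ∑ k ∈ indexSet d N, multinomialProb k N x * (k j * s ^ (k j - 1)))
      (∑ k ∈ indexSet d N, multinomialProb k N x *
        (k j * ((k j - 1 : ℕ) * 1 ^ (k j - 1 - 1)))) 1 :=
    HasDerivAt.fun_sum fun k _ => ((hasDerivAt_pow (k j - 1) (1 : ℝ)).const_mul _).const_mul _
  have h2 : HasDerivAt (fun s : ℝ => N * (1 + x j * (s - 1)) ^ (N - 1) * x j)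
      (N * ((N - 1 : ℕ) * (1 + x j * (1 - 1)) ^ (N - 1 - 1) * x j) * x j) 1 := by
    have h3 : HasDerivAt (fun s : ℝ => 1 + x j * (s - 1)) (x j) 1 := by
      simpa using (((hasDerivAt_id (1 : ℝ)).sub_const 1).const_mul (x j)).const_add 1
    exact ((h3.fun_pow (N - 1)).const_mul (N : ℝ)).mul_const (x j)
  have h4 := h1.unique (by simpa only [sum_multinomialProb_mul_pred_pow hx j] using h2)
  have key : ∀ n : ℕ, (n : ℝ) * ((n - 1 : ℕ) : ℝ) = n * (n - 1) := by
    intro n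
    cases n <;> simp
  simp only [one_pow, mul_one, sub_self, mul_zero, add_zero, key] at h4
  rw [h4, ← mul_assoc, key]
  ring

/-- The mean absolute deviation of `k j / m` from `x j` is at most `1 / √m`. -/
lemma sum_multinomialProb_mul_abs_sub_le {m : ℕ} (hm : 1 ≤ m) (hx : ∀ i, 0 ≤ x i)
    (hs : ∑ i, x i ≤ 1) (j : Fin d) :
    ∑ k ∈ indexSet d (m - 1), multinomialProb k (m - 1) x * |(k j : ℝ) / m - x j|
      ≤ 1 / √m := by
  have hm0 : (0 : ℝ) < m := by exact_mod_cast hm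
  have hxj : x j ≤ 1 := (Finset.single_le_sum (f := x) (fun i _ => hx i)
    (Finset.mem_univ j)).trans hs
  have hr : 0 < √(m : ℝ) := Real.sqrt_pos.2 hm0
  have hrr : √(m : ℝ) * √m = m := Real.mul_self_sqrt hm0.le
  have hcast : ((m - 1 : ℕ) : ℝ) = m - 1 := by rw [Nat.cast_sub hm]; simp
  have hvar : ∑ k ∈ indexSet d (m - 1), multinomialProb k (m - 1) x * ((k j : ℝ) / m - x j) ^ 2
      = ((m - 1) * x j * (1 - x j) + x j ^ 2) / m ^ 2 := by
    have e : ∀ k : Fin d → ℕ, multinomialProb k (m - 1) x * ((k j : ℝ) / m - x j) ^ 2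
        = (1 / m ^ 2) * (multinomialProb k (m - 1) x * (k j * (k j - 1)))
          + (1 / m ^ 2 - 2 * x j / m) * (multinomialProb k (m - 1) x * k j)
          + x j ^ 2 * multinomialProb k (m - 1) x := by
      intro k; field_simp; ring
    simp only [e, Finset.sum_add_distrib, ← Finset.mul_sum, sum_multinomialProb_mul hx,
      sum_multinomialProb_mul_mul_sub_one hx, sum_multinomialProb hx, hcast]
    field_simp
    ring
  have hvar_le : ∑ k ∈ indexSet d (m - 1), multinomialProb k (m - 1) x *
      ((k j : ℝ) / m - x j) ^ 2 ≤ 1 / m := by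
    rw [hvar, div_le_div_iff₀ (by positivity) hm0]
    have h1 : (1 : ℝ) ≤ m := by exact_mod_cast hm
    have : (m - 1) * x j * (1 - x j) + x j ^ 2 ≤ m := by
      nlinarith [hx j, mul_nonneg (hx j) (sub_nonneg.2 hxj),
        mul_nonneg (sub_nonneg.2 h1) (mul_nonneg (hx j) (hx j)),
        mul_nonneg (sub_nonneg.2 h1) (sub_nonneg.2 hxj)]
    nlinarith
  -- AM-GM in the form `2u ≤ √m u² + 1/√m`, balanced for a second moment of size `1/m`.
  calc _ ≤ ∑ k ∈ indexSet d (m - 1), multinomialProb k (m - 1) x *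
        ((√m * ((k j : ℝ) / m - x j) ^ 2 + 1 / √m) / 2) := by
        refine Finset.sum_le_sum fun k hk => ?_
        refine mul_le_mul_of_nonneg_left ?_ (multinomialProb_nonneg hx hs hk)
        rw [← sq_abs ((k j : ℝ) / m - x j)]
        generalize |(k j : ℝ) / m - x j| = u
        have : √m * u ^ 2 + 1 / √m - 2 * u = (√m * u - 1) ^ 2 / √m := by
          field_simp; ring
        have : 0 ≤ (√m * u - 1) ^ 2 / √m := by positivity
        linarith
    _ = √m / 2 * (∑ k ∈ indexSet d (m - 1), multinomialProb k (m - 1) x *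
        ((k j : ℝ) / m - x j) ^ 2) + 1 / √m / 2 * ∑ k ∈ indexSet d (m - 1),
          multinomialProb k (m - 1) x := by
        rw [Finset.mul_sum, Finset.mul_sum, ← Finset.sum_add_distrib]
        refine Finset.sum_congr rfl fun k _ => by ring
    _ ≤ √m / 2 * (1 / m) + 1 / √m / 2 * 1 := by
        rw [sum_multinomialProb hx]
        gcongr
    _ = 1 / √m := by
        have : (1 : ℝ) / m = 1 / √m * (1 / √m) := by rw [one_div_mul_one_div, hrr]
        rw [this]; field_simp; ring

end Moments

/-! ### Characters on the torus -/

/-- The uniform probability measure on `(-π, π]`. -/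
noncomputable def circleMeasure : Measure ℝ :=
  ENNReal.ofReal (1 / (2 * Real.pi)) • volume.restrict (Set.Ioc (-Real.pi) Real.pi)

instance : IsProbabilityMeasure circleMeasure := by
  constructor
  have hp := Real.pi_pos
  rw [circleMeasure, Measure.smul_apply, Measure.restrict_apply_univ, Real.volume_Ioc,
    smul_eq_mul, ← ENNReal.ofReal_mul (by positivity)]
  rw [show 1 / (2 * Real.pi) * (Real.pi - -Real.pi) = 1 by field_simp; ring, ENNReal.ofReal_one]

lemma integral_circleMeasure {E : Type*} [NormedAddCommGroup E] [NormedSpace ℝ E] (g : ℝ → E) :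
    ∫ t, g t ∂circleMeasure
      = (1 / (2 * Real.pi)) • ∫ t in (-Real.pi)..Real.pi, g t := by
  have hp := Real.pi_pos
  rw [circleMeasure, integral_smul_measure, ENNReal.toReal_ofReal (by positivity),
    intervalIntegral.integral_of_le (by linarith)]

lemma ae_circleMeasure : ∀ᵐ t ∂circleMeasure, |t| ≤ Real.pi := by
  have h : ∀ᵐ t ∂(volume.restrict (Set.Ioc (-Real.pi) Real.pi)), |t| ≤ Real.pi := by
    filter_upwards [ae_restrict_mem measurableSet_Ioc] with t ht
    exact abs_le.2 ⟨ht.1.le, ht.2⟩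
  exact Measure.ae_smul_measure h _

/-- The uniform probability measure on the box `(-π, π]^ι`. -/
noncomputable def torusMeasure (ι : Type*) [Fintype ι] : Measure (ι → ℝ) :=
  Measure.pi fun _ => circleMeasure

instance (ι : Type*) [Fintype ι] : IsProbabilityMeasure (torusMeasure ι) := by
  unfold torusMeasure; infer_instance

section Torus

variable {ι : Type*} [Fintype ι]

lemma ae_torusMeasure : ∀ᵐ t ∂torusMeasure ι, ∀ i, |t i| ≤ Real.pi :=
  ae_all_iff.2 fun i => (Measure.tendsto_eval_ae_ae (μ := fun _ : ι => circleMeasure)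
    (i := i)).eventually ae_circleMeasure

lemma integral_torusMeasure_prod {𝕜 : Type*} [RCLike 𝕜] (g : ι → ℝ → 𝕜) :
    ∫ t, ∏ i, g i (t i) ∂torusMeasure ι = ∏ i, ∫ t, g i t ∂circleMeasure :=
  integral_fintype_prod_eq_prod g

lemma integral_circleMeasure_exp (k : ℤ) :
    ∫ t : ℝ, Complex.exp (k * t * Complex.I) ∂circleMeasure = if k = 0 then 1 else 0 := by
  have hp := Real.pi_pos
  rw [integral_circleMeasure]
  split_ifs with hk
  · subst hk
    simp only [Int.cast_zero, zero_mul, Complex.exp_zero, intervalIntegral.integral_const,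
      smul_smul]
    rw [show 1 / (2 * Real.pi) * (Real.pi - -Real.pi) = 1 by field_simp; ring, one_smul]
  · have hc : (k : ℂ) * Complex.I ≠ 0 := by simp [hk]
    have e : ∀ t : ℝ, Complex.exp (k * t * Complex.I) = Complex.exp (k * Complex.I * t) := by
      intro t; congr 1; ring
    simp only [e]
    rw [integral_exp_mul_complex hc]
    -- The exponents at the two endpoints differ by `2πik`.
    have h2 : Complex.exp (k * Complex.I * (Real.pi : ℝ))
        = Complex.exp (k * Complex.I * ((-Real.pi : ℝ) : ℂ)) := by
      rw [Complex.exp_eq_exp_iff_exists_int]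
      exact ⟨k, by push_cast; ring⟩
    rw [h2, sub_self, zero_div, smul_zero]

lemma integral_torusMeasure_exp (k : ι → ℤ) :
    ∫ t, Complex.exp ((∑ i, k i * (t i : ℂ)) * Complex.I) ∂torusMeasure ι
      = if k = 0 then 1 else 0 := by
  have e : ∀ t : ι → ℝ, Complex.exp ((∑ i, k i * (t i : ℂ)) * Complex.I)
      = ∏ i, Complex.exp (k i * (t i : ℝ) * Complex.I) := by
    intro t; rw [Finset.sum_mul, Complex.exp_sum]
  simp only [e]
  rw [integral_torusMeasure_prod (fun i t => Complex.exp (k i * (t : ℝ) * Complex.I))]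
  simp only [integral_circleMeasure_exp]
  rw [Finset.prod_ite_zero]
  simp [funext_iff]

/-! ### Characteristic function of a multinomial step -/

/-- The characteristic function at `t` of one step of the multinomial walk with probabilities
`x i` of moving in direction `i` and `1 - ∑ x i` of not moving. -/
noncomputable def stepChar (x t : ι → ℝ) : ℂ :=
  1 + ∑ i, x i * (Complex.exp (t i * Complex.I) - 1)

@[fun_prop]
lemma continuous_stepChar (x : ι → ℝ) : Continuous (stepChar x) := by
  unfold stepChar; fun_prop

lemma stepChar_re (x t : ι → ℝ) :
    (stepChar x t).re = 1 - ∑ i, x i * (1 - Real.cos (t i)) := by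
  simp only [stepChar, Complex.add_re, Complex.one_re, Complex.re_sum, Complex.re_ofReal_mul,
    Complex.sub_re, Complex.exp_ofReal_mul_I_re]
  rw [sub_eq_add_neg, ← Finset.sum_neg_distrib]
  congr 1
  exact Finset.sum_congr rfl fun i _ => by ring

lemma stepChar_im (x t : ι → ℝ) : (stepChar x t).im = ∑ i, x i * Real.sin (t i) := by
  simp [stepChar, Complex.exp_ofReal_mul_I_im]

lemma stepChar_eq (x t : ι → ℝ) :
    stepChar x t = ((1 - ∑ i, x i : ℝ) : ℂ) + ∑ i, x i * Complex.exp (t i * Complex.I) := by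
  simp only [stepChar, mul_sub, Finset.sum_sub_distrib, mul_one]
  push_cast
  ring

lemma norm_stepChar_sq (x t : ι → ℝ) : ‖stepChar x t‖ ^ 2
    = (1 - ∑ i, x i * (1 - Real.cos (t i))) ^ 2 + (∑ i, x i * Real.sin (t i)) ^ 2 := by
  rw [← Complex.normSq_eq_norm_sq, Complex.normSq_apply, stepChar_re, stepChar_im]
  ring

lemma norm_stepChar_le_one {x : ι → ℝ} (hx : ∀ i, 0 ≤ x i) (hs : ∑ i, x i ≤ 1) (t : ι → ℝ) :
    ‖stepChar x t‖ ≤ 1 := by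
  rw [stepChar_eq]
  calc _ ≤ ‖((1 - ∑ i, x i : ℝ) : ℂ)‖ + ∑ i, ‖(x i : ℂ) * Complex.exp (t i * Complex.I)‖ :=
        (norm_add_le _ _).trans (add_le_add_right (norm_sum_le _ _) _)
    _ = 1 := by
        simp only [norm_mul, Complex.norm_exp_ofReal_mul_I, mul_one, Complex.norm_real,
          Real.norm_eq_abs, abs_of_nonneg (hx _), abs_of_nonneg (sub_nonneg.2 hs)]
        ring

/-- With `c = 1 - ∑ x` the step characteristic function is `c + U`, and `‖U‖ ≤ 1 - c`. Expanding `c²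
+ 2c Re U + ‖U‖²` gives at most `1 - 2c (1 - c - Re U)`: the mass `c` of not moving is what produces
the decay. -/
lemma norm_stepChar_sq_le {x : ι → ℝ} (hx : ∀ i, 0 ≤ x i) (t : ι → ℝ) :
    ‖stepChar x t‖ ^ 2 ≤ 1 - 2 * (1 - ∑ i, x i) * ∑ i, x i * (1 - Real.cos (t i)) := by
  set U : ℂ := ∑ i, x i * Complex.exp (t i * Complex.I) with hU
  have h1 : ‖U‖ ≤ ∑ i, x i := by
    refine (norm_sum_le _ _).trans_eq (Finset.sum_congr rfl fun i _ => ?_)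
    simp [Complex.norm_exp_ofReal_mul_I, abs_of_nonneg (hx _)]
  have h2 : U.re = ∑ i, x i * Real.cos (t i) := by
    simp [hU, Complex.re_sum, Complex.exp_ofReal_mul_I_re]
  have h3 : ‖U‖ ^ 2 ≤ (∑ i, x i) ^ 2 := by gcongr
  rw [stepChar_eq, ← hU, ← Complex.normSq_eq_norm_sq, Complex.normSq_apply]
  rw [← Complex.normSq_eq_norm_sq, Complex.normSq_apply] at h3
  simp only [Complex.add_re, Complex.add_im, Complex.ofReal_re, Complex.ofReal_im, zero_add]
  simp only [mul_sub, mul_one, Finset.sum_sub_distrib, ← h2]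
  nlinarith

/-- Gaussian bound for the step characteristic function on the box `[-π, π]^ι`. -/
lemma norm_stepChar_sq_le_exp {x : ι → ℝ} (hx : ∀ i, 0 ≤ x i) (hs : ∑ i, x i ≤ 1) {t : ι → ℝ}
    (ht : ∀ i, |t i| ≤ Real.pi) :
    ‖stepChar x t‖ ^ 2
      ≤ Real.exp (-(4 * (1 - ∑ i, x i) / Real.pi ^ 2) * ∑ i, x i * t i ^ 2) := by
  refine (norm_stepChar_sq_le hx t).trans (le_trans ?_ (Real.add_one_le_exp _))
  have h : (2 / Real.pi ^ 2) * ∑ i, x i * t i ^ 2 ≤ ∑ i, x i * (1 - Real.cos (t i)) := by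
    rw [Finset.mul_sum]
    refine Finset.sum_le_sum fun i _ => ?_
    have := mul_le_mul_of_nonneg_left (Real.cos_le_one_sub_mul_cos_sq (ht i)) (hx i)
    linarith
  have h2 := mul_le_mul_of_nonneg_left h (mul_nonneg zero_le_two (sub_nonneg.2 hs))
  calc _ ≤ 1 - 2 * (1 - ∑ i, x i) * (2 / Real.pi ^ 2 * ∑ i, x i * t i ^ 2) := by linarith
    _ = _ := by ring

lemma integrable_torusMeasure_of_continuous {E : Type*} [NormedAddCommGroup E]
    [SecondCountableTopology E] {g : (ι → ℝ) → E} (hg : Continuous g) {B : ℝ}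
    (hB : ∀ t, ‖g t‖ ≤ B) : Integrable g (torusMeasure ι) := by
  borelize E
  exact Integrable.of_bound hg.measurable.aestronglyMeasurable B (ae_of_all _ hB)

end Torus

/-! ### Fourier inversion and Parseval -/

section Fourier

variable {d N : ℕ} {x : Fin d → ℝ}

lemma stepChar_pow (hx : ∀ i, 0 ≤ x i) (t : Fin d → ℝ) :
    stepChar x t ^ N = ∑ k ∈ indexSet d N,
      (multinomialProb k N x : ℂ) * Complex.exp ((∑ i, k i * (t i : ℂ)) * Complex.I) := by
  rw [stepChar_eq, ← sum_multinomialCoeff_mul_pow]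
  refine Finset.sum_congr rfl fun k hk => ?_
  rw [multinomialProb_eq (mem_indexSet.1 hk) hx, Finset.sum_mul, Complex.exp_sum]
  push_cast
  simp only [mul_pow, Finset.prod_mul_distrib, ← Complex.exp_nat_mul, mul_assoc]

lemma norm_exp_sum_mul_I (k : Fin d → ℝ) (t : Fin d → ℝ) :
    ‖Complex.exp ((∑ i, (k i : ℂ) * (t i : ℂ)) * Complex.I)‖ = 1 := by
  have : (∑ i, (k i : ℂ) * (t i : ℂ)) = ((∑ i, k i * t i : ℝ) : ℂ) := by push_cast; rfl
  rw [this, Complex.norm_exp_ofReal_mul_I]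

/-- Orthogonality of characters: after multiplication by the conjugate character of `l`, only the
term `k = l` has nonzero mean. -/
theorem integral_sum_mul_exp (c : (Fin d → ℕ) → ℂ) (S : Finset (Fin d → ℕ)) (l : Fin d → ℕ)
    (hl : l ∈ S) :
    ∫ t, (∑ k ∈ S, c k * Complex.exp ((∑ i, k i * (t i : ℂ)) * Complex.I))
      * Complex.exp (-(∑ i, l i * (t i : ℂ)) * Complex.I) ∂torusMeasure (Fin d) = c l := by
  have e : ∀ t : Fin d → ℝ,
      (∑ k ∈ S, c k * Complex.exp ((∑ i, k i * (t i : ℂ)) * Complex.I))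
      * Complex.exp (-(∑ i, l i * (t i : ℂ)) * Complex.I)
      = ∑ k ∈ S, c k * Complex.exp ((∑ i, ((fun i => (k i : ℤ) - (l i : ℤ)) i : ℤ) * (t i : ℂ))
        * Complex.I) := by
    intro t
    rw [Finset.sum_mul]
    refine Finset.sum_congr rfl fun k _ => ?_
    rw [mul_assoc, ← Complex.exp_add]
    congr 2
    push_cast
    simp only [sub_mul, Finset.sum_sub_distrib]
    ring
  simp only [e]
  rw [integral_finsetSum]
  · simp only [integral_const_mul, integral_torusMeasure_exp]
    rw [Finset.sum_eq_single l]
    · simp [funext_iff]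
    · intro k _ hkl
      rw [if_neg, mul_zero]
      contrapose! hkl
      ext i
      have := congrFun hkl i
      simp only [Pi.zero_apply] at this
      omega
    · exact fun h => absurd hl h
  · intro k _
    refine (integrable_torusMeasure_of_continuous (B := 1) (by fun_prop) fun t => ?_).const_mul _
    exact (norm_exp_sum_mul_I (fun i => (((k i : ℤ) - (l i : ℤ) : ℤ) : ℝ)) t ▸ by simp)

/-- The sup bound on multinomial probabilities by the `L¹` norm of the characteristic function. -/
lemma multinomialProb_le_integral {k : Fin d → ℕ} (hx : ∀ i, 0 ≤ x i) (hk : k ∈ indexSet d N) :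
    multinomialProb k N x ≤ ∫ t, ‖stepChar x t‖ ^ N ∂torusMeasure (Fin d) := by
  have h := integral_sum_mul_exp (fun k => (multinomialProb k N x : ℂ)) (indexSet d N) k hk
  simp only [← stepChar_pow hx] at h
  calc multinomialProb k N x ≤ ‖(multinomialProb k N x : ℂ)‖ := by
        rw [Complex.norm_real]; exact le_abs_self _
    _ ≤ ∫ t, ‖stepChar x t ^ N * Complex.exp (-(∑ i, k i * (t i : ℂ)) * Complex.I)‖
        ∂torusMeasure (Fin d) := by
        rw [← h]; exact norm_integral_le_integral_norm _
    _ = _ := by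
        refine integral_congr_ae (ae_of_all _ fun t => ?_)
        have := norm_exp_sum_mul_I (fun i => -(k i : ℝ)) t
        simp only [Complex.ofReal_neg, Complex.ofReal_natCast, neg_mul, Finset.sum_neg_distrib]
          at this
        simp only [norm_mul, norm_pow, neg_mul, this, mul_one]

/-- Parseval's identity for the multinomial distribution. -/
lemma sum_multinomialProb_sq (hx : ∀ i, 0 ≤ x i) (hs : ∑ i, x i ≤ 1) :
    ∑ k ∈ indexSet d N, multinomialProb k N x ^ 2
      = ∫ t, (‖stepChar x t‖ ^ 2) ^ N ∂torusMeasure (Fin d) := by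
  apply Complex.ofReal_injective
  rw [← integral_complex_ofReal]
  have e : ∀ t : Fin d → ℝ, (((‖stepChar x t‖ ^ 2) ^ N : ℝ) : ℂ)
      = ∑ l ∈ indexSet d N, (multinomialProb l N x : ℂ) *
        (stepChar x t ^ N * Complex.exp (-(∑ i, l i * (t i : ℂ)) * Complex.I)) := by
    intro t
    have h1 : (starRingEnd ℂ) (stepChar x t ^ N) = ∑ k ∈ indexSet d N,
        (multinomialProb k N x : ℂ) * Complex.exp (-(∑ i, k i * (t i : ℂ)) * Complex.I) := by
      rw [stepChar_pow hx, map_sum]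
      refine Finset.sum_congr rfl fun k _ => ?_
      rw [map_mul, Complex.conj_ofReal, ← Complex.exp_conj]
      simp [map_sum]
    rw [← pow_mul, mul_comm 2 N, pow_mul, ← norm_pow, ← Complex.normSq_eq_norm_sq,
      ← Complex.mul_conj, h1, Finset.mul_sum]
    refine Finset.sum_congr rfl fun k _ => by ring
  simp only [e]
  rw [integral_finsetSum]
  · push_cast
    refine Finset.sum_congr rfl fun l hl => ?_
    have h := integral_sum_mul_exp (fun k => (multinomialProb k N x : ℂ)) (indexSet d N) l hl
    simp only [← stepChar_pow hx] at h
    rw [integral_const_mul, h, sq]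
  · intro l _
    refine (integrable_torusMeasure_of_continuous (B := 1) (by fun_prop) fun t => ?_).const_mul _
    have := norm_exp_sum_mul_I (fun i => -(l i : ℝ)) t
    simp only [Complex.ofReal_neg, Complex.ofReal_natCast, neg_mul, Finset.sum_neg_distrib]
      at this
    simp only [norm_mul, norm_pow, neg_mul, this, mul_one]
    exact pow_le_one₀ (norm_nonneg _) (norm_stepChar_le_one hx hs t)

end Fourier

/-! ### Gaussian limit of the collision integral -/

section GaussianLimit

variable {ι : Type*} [Fintype ι]

lemma torusMeasure_eq_smul : torusMeasure ι
    = (ENNReal.ofReal (1 / (2 * Real.pi))) ^ Fintype.card ι •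
      (volume : Measure (ι → ℝ)).restrict
        (Set.univ.pi fun _ => Set.Ioc (-Real.pi) Real.pi) := by
  rw [torusMeasure]
  refine Measure.pi_eq fun s hs => ?_
  rw [volume_pi, Measure.restrict_pi_pi, Measure.smul_apply, Measure.pi_pi]
  simp only [circleMeasure, Measure.smul_apply, smul_eq_mul, Finset.prod_mul_distrib,
    Finset.prod_const, Finset.card_univ]

lemma integral_torusMeasure {E : Type*} [NormedAddCommGroup E] [NormedSpace ℝ E]
    (g : (ι → ℝ) → E) :
    ∫ t, g t ∂torusMeasure ι = ((1 / (2 * Real.pi)) ^ Fintype.card ι) •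
      ∫ t, (Set.univ.pi fun _ => Set.Ioc (-Real.pi) Real.pi).indicator g t := by
  have hp := Real.pi_pos
  rw [torusMeasure_eq_smul, integral_smul_measure, ENNReal.toReal_pow,
    ENNReal.toReal_ofReal (by positivity), integral_indicator]
  exact MeasurableSet.univ_pi fun _ => measurableSet_Ioc

/-- A rank-one shear along `(1, …, 1)` removes the term `-(∑ y s)²` from the covariance form: on the
left, that square appears with coefficient `-(2α - α² ∑ y)`, which `hα` sets to `-1`. -/
lemma sum_smul_sq_sub_sq (y s : ι → ℝ) {α : ℝ}
    (hα : 2 * α - α ^ 2 * ∑ i, y i = 1) :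
    ∑ i, y i * (s i - α * ∑ j, y j * s j) ^ 2
      = ∑ i, y i * s i ^ 2 - (∑ i, y i * s i) ^ 2 := by
  set w := ∑ j, y j * s j with hw
  have e : ∀ i, y i * (s i - α * w) ^ 2
      = y i * s i ^ 2 - 2 * α * w * (y i * s i) + α ^ 2 * w ^ 2 * y i := fun i => by ring
  simp only [e, Finset.sum_add_distrib, Finset.sum_sub_distrib, ← Finset.mul_sum, ← hw]
  linear_combination (-w ^ 2) * hα

lemma integral_exp_neg_sum_sq :
    ∫ u : ι → ℝ, Real.exp (-∑ i, u i ^ 2) = √Real.pi ^ Fintype.card ι := by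
  have e : ∀ u : ι → ℝ, Real.exp (-∑ i, u i ^ 2) = ∏ i, Real.exp (-1 * u i ^ 2) := by
    intro u; rw [← Real.exp_sum, ← Finset.mul_sum]; simp
  simp only [e]
  rw [integral_fintype_prod_volume_eq_pow (fun u : ℝ => Real.exp (-1 * u ^ 2)),
    integral_gaussian, div_one]

/-- The Gaussian integral attached to the covariance matrix `diag y - y yᵀ`. -/
lemma integral_exp_neg_covariance {y : ι → ℝ} (hy : ∀ i, 0 < y i) (hs : ∑ i, y i < 1) :
    ∫ s : ι → ℝ, Real.exp (-(∑ i, y i * s i ^ 2 - (∑ i, y i * s i) ^ 2))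
      = √Real.pi ^ Fintype.card ι / √((1 - ∑ i, y i) * ∏ i, y i) := by
  classical
  set c := 1 - ∑ i, y i with hc
  have hc0 : 0 < c := by linarith
  have hr : 0 < √c := Real.sqrt_pos.2 hc0
  have hrr : √c ^ 2 = c := Real.sq_sqrt hc0.le
  -- A root of `2α - α² (1 - c) = 1`. The shear then has determinant `1 - α ∑ y = √c`, and `M`
  -- below, which also rescales by `√(y i)`, turns the form into the standard sum of squares.
  set α := 1 / (1 + √c) with hα
  have hσ : ∑ i, y i = 1 - √c ^ 2 := by rw [hrr]; linarith
  have hα2 : 2 * α - α ^ 2 * ∑ i, y i = 1 := by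
    rw [hσ, hα]; field_simp; ring
  set M : Matrix ι ι ℝ := Matrix.diagonal (fun i => √(y i)) *
    (1 + Matrix.replicateCol Unit (fun _ => -α) * Matrix.replicateRow Unit y) with hM
  have hdet : M.det = √(c * ∏ i, y i) := by
    rw [hM, Matrix.det_mul, Matrix.det_diagonal, Matrix.det_one_add_replicateCol_mul_replicateRow,
      Real.sqrt_mul hc0.le, Real.sqrt_prod Finset.univ (fun i _ => (hy i).le)]
    have : 1 + y ⬝ᵥ (fun _ => -α) = √c := by
      simp only [dotProduct, mul_neg, Finset.sum_neg_distrib, ← Finset.sum_mul, hσ, hα]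
      field_simp; ring
    rw [this, mul_comm]
  have hdet0 : 0 < M.det := by
    rw [hdet]
    exact Real.sqrt_pos.2 (mul_pos hc0 (Finset.prod_pos fun i _ => hy i))
  have hMs : ∀ s : ι → ℝ, ∀ i, Matrix.toLin' M s i = √(y i) * (s i - α * ∑ j, y j * s j) := by
    intro s i
    rw [Matrix.toLin'_apply, hM, ← Matrix.mulVec_mulVec, Matrix.mulVec_diagonal,
      Matrix.add_mulVec, Matrix.one_mulVec]
    congr 1
    simp [Matrix.mulVec, dotProduct, Matrix.mul_apply, Finset.mul_sum, mul_assoc,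
      sub_eq_add_neg]
  have e : ∀ s : ι → ℝ, Real.exp (-(∑ i, y i * s i ^ 2 - (∑ i, y i * s i) ^ 2))
      = Real.exp (-∑ i, (Matrix.toLin' M s i) ^ 2) := by
    intro s
    rw [← sum_smul_sq_sub_sq y s hα2]
    simp only [hMs, mul_pow, Real.sq_sqrt (hy _).le]
  simp only [e]
  have hmeas : Measurable (Matrix.toLin' M) :=
    (LinearMap.continuous_on_pi (Matrix.toLin' M)).measurable
  have hcont : Continuous fun u : ι → ℝ => Real.exp (-∑ i, u i ^ 2) := by fun_prop
  rw [← integral_map (f := fun u : ι → ℝ => Real.exp (-∑ i, u i ^ 2)) hmeas.aemeasurable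
    hcont.measurable.aestronglyMeasurable, Real.map_matrix_volume_pi_eq_smul_volume_pi hdet0.ne',
    integral_smul_measure, integral_exp_neg_sum_sq, ENNReal.toReal_ofReal (abs_nonneg _),
    abs_of_pos (inv_pos.2 hdet0), hdet, smul_eq_mul]
  field_simp

lemma tendsto_sqrt_mul_sin (s : ℝ) :
    Tendsto (fun m : ℕ => √(m : ℝ) * Real.sin (s / √m)) atTop (𝓝 s) := by
  have h1 : Tendsto (fun m : ℕ => s / √(m : ℝ)) atTop (𝓝 0) :=
    tendsto_const_nhds.div_atTop (Real.tendsto_sqrt_atTop.comp tendsto_natCast_atTop_atTop)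
  have h2 : Tendsto (fun m : ℕ => s * Real.sinc (s / √(m : ℝ))) atTop (𝓝 (s * Real.sinc 0)) :=
    ((Real.continuous_sinc.tendsto 0).comp h1).const_mul s
  rw [Real.sinc_zero, mul_one] at h2
  refine h2.congr' ?_
  filter_upwards [eventually_gt_atTop 0] with m hm
  have hr : 0 < √(m : ℝ) := Real.sqrt_pos.2 (by exact_mod_cast hm)
  by_cases hs : s = 0
  · simp [hs]
  · rw [Real.sinc_of_ne_zero (by positivity)]
    field_simp

lemma tendsto_mul_one_sub_cos (s : ℝ) :
    Tendsto (fun m : ℕ => (m : ℝ) * (1 - Real.cos (s / √m))) atTop (𝓝 (s ^ 2 / 2)) := by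
  have h := ((tendsto_sqrt_mul_sin (s / 2)).pow 2).const_mul 2
  have e : 2 * (s / 2) ^ 2 = s ^ 2 / 2 := by ring
  rw [e] at h
  refine h.congr fun m => ?_
  have h1 : Real.cos (s / √m) = 1 - 2 * Real.sin (s / 2 / √m) ^ 2 := by
    rw [show s / √m = 2 * (s / 2 / √m) by ring, Real.cos_two_mul]
    linarith [Real.sin_sq_add_cos_sq (s / 2 / √m)]
  rw [h1, mul_pow, Real.sq_sqrt (Nat.cast_nonneg m)]
  ring

/-- The squared modulus is `(1 - A)² + B²` with `A = ∑ y (1 - cos)` and `B = ∑ y sin`. At `t = s /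
√m` one has `m A → ∑ y s² / 2`, `√m B → ∑ y s`, and `m A² → 0`. -/
lemma tendsto_mul_norm_stepChar_sq_sub_one (y s : ι → ℝ) :
    Tendsto (fun m : ℕ => (m : ℝ) * (‖stepChar y ((1 / √(m : ℝ)) • s)‖ ^ 2 - 1)) atTop
      (𝓝 (-(∑ i, y i * s i ^ 2 - (∑ i, y i * s i) ^ 2))) := by
  have hA : Tendsto (fun m : ℕ => ∑ i, y i * ((m : ℝ) * (1 - Real.cos (s i / √m)))) atTop
      (𝓝 (∑ i, y i * (s i ^ 2 / 2))) :=
    tendsto_finsetSum _ fun i _ => (tendsto_mul_one_sub_cos (s i)).const_mul _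
  have hB : Tendsto (fun m : ℕ => ∑ i, y i * (√(m : ℝ) * Real.sin (s i / √m))) atTop
      (𝓝 (∑ i, y i * s i)) :=
    tendsto_finsetSum _ fun i _ => (tendsto_sqrt_mul_sin (s i)).const_mul _
  have hm : Tendsto (fun m : ℕ => 1 / (m : ℝ)) atTop (𝓝 0) := tendsto_one_div_atTop_nhds_zero_nat
  have h := ((hA.const_mul (-2)).add ((hA.pow 2).mul hm)).add (hB.pow 2)
  have e : -2 * ∑ i, y i * (s i ^ 2 / 2) + (∑ i, y i * (s i ^ 2 / 2)) ^ 2 * 0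
      + (∑ i, y i * s i) ^ 2 = -(∑ i, y i * s i ^ 2 - (∑ i, y i * s i) ^ 2) := by
    have : ∑ i, y i * (s i ^ 2 / 2) = (∑ i, y i * s i ^ 2) / 2 := by
      rw [Finset.sum_div]; exact Finset.sum_congr rfl fun i _ => by ring
    rw [this]; ring
  rw [e] at h
  refine h.congr' ?_
  filter_upwards [eventually_gt_atTop 0] with m hm
  have hm0 : (0 : ℝ) < m := by exact_mod_cast hm
  have hA' : ∑ i, y i * ((m : ℝ) * (1 - Real.cos (s i / √m)))
      = m * ∑ i, y i * (1 - Real.cos (s i / √m)) := by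
    rw [Finset.mul_sum]; exact Finset.sum_congr rfl fun i _ => by ring
  have hB' : ∑ i, y i * (√(m : ℝ) * Real.sin (s i / √m))
      = √m * ∑ i, y i * Real.sin (s i / √m) := by
    rw [Finset.mul_sum]; exact Finset.sum_congr rfl fun i _ => by ring
  have e2 : ∀ i, ((1 / √(m : ℝ)) • s) i = s i / √m := fun i => by
    simp [div_eq_inv_mul]
  rw [norm_stepChar_sq, hA', hB', mul_pow (√(m : ℝ)), Real.sq_sqrt hm0.le]
  simp only [e2]
  field_simp
  ring

lemma tendsto_norm_stepChar_sq_pow (y s : ι → ℝ) :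
    Tendsto (fun m : ℕ => (‖stepChar y ((1 / √(m : ℝ)) • s)‖ ^ 2) ^ (m - 1)) atTop
      (𝓝 (Real.exp (-(∑ i, y i * s i ^ 2 - (∑ i, y i * s i) ^ 2)))) := by
  have h1 := tendsto_mul_norm_stepChar_sq_sub_one y s
  -- The exponential limit is for the power `m`; the one superfluous factor tends to `1` and is
  -- divided out below.
  have h2 := Real.tendsto_one_add_pow_exp_of_tendsto h1
  have hz : Tendsto (fun m : ℕ => ‖stepChar y ((1 / √(m : ℝ)) • s)‖ ^ 2) atTop (𝓝 1) := by
    have hm : Tendsto (fun m : ℕ => 1 / (m : ℝ)) atTop (𝓝 0) :=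
      tendsto_one_div_atTop_nhds_zero_nat
    have := (h1.mul hm).add_const 1
    rw [mul_zero, zero_add] at this
    refine this.congr' ?_
    filter_upwards [eventually_gt_atTop 0] with m hm
    have hm0 : (0 : ℝ) < m := by exact_mod_cast hm
    field_simp
    ring
  have h3 := h2.div hz one_ne_zero
  rw [div_one] at h3
  refine h3.congr' ?_
  filter_upwards [eventually_gt_atTop 0, hz.eventually (lt_mem_nhds zero_lt_one)] with m hm hpos
  obtain ⟨N, rfl⟩ : ∃ N, m = N + 1 := ⟨m - 1, by omega⟩
  simp only [add_sub_cancel, Nat.add_sub_cancel]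
  simp only [Pi.div_apply]
  rw [pow_succ, mul_div_assoc, div_self hpos.ne', mul_one]

/-- The local limit theorem for the sum of the squared multinomial probabilities, in Fourier
form. -/
theorem tendsto_rpow_mul_integral_stepChar {y : ι → ℝ} (hy : ∀ i, 0 < y i)
    (hs : ∑ i, y i < 1) :
    Tendsto (fun m : ℕ => (m : ℝ) ^ ((Fintype.card ι : ℝ) / 2) *
      ∫ t, (‖stepChar y t‖ ^ 2) ^ (m - 1) ∂torusMeasure ι) atTop
      (𝓝 (((4 * Real.pi) ^ Fintype.card ι * (1 - ∑ i, y i) * ∏ i, y i) ^ (-(1 / 2) : ℝ))) := by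
  have hp := Real.pi_pos
  set c := 1 - ∑ i, y i with hc
  have hc0 : 0 < c := by linarith
  set box : Set (ι → ℝ) := Set.univ.pi fun _ => Set.Ioc (-Real.pi) Real.pi with hbox
  set κ := 4 * c / Real.pi ^ 2 with hκ
  have hκ0 : 0 < κ := by positivity
  -- The substitution `t = s / √m` absorbs the power of `m`. The indicator confines `s / √m` to the
  -- box, where the Gaussian domination holds.
  set G : ℕ → (ι → ℝ) → ℝ := fun m s =>
    box.indicator (fun t => (‖stepChar y t‖ ^ 2) ^ (m - 1)) ((1 / √(m : ℝ)) • s) with hG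
  have hlim : Tendsto (fun m => ∫ s, G m s) atTop
      (𝓝 (∫ s : ι → ℝ, Real.exp (-(∑ i, y i * s i ^ 2 - (∑ i, y i * s i) ^ 2)))) := by
    refine tendsto_integral_filter_of_dominated_convergence
      (fun s => ∏ i, Real.exp (-(κ / 2 * y i) * s i ^ 2)) ?_ ?_ ?_ ?_
    · refine Eventually.of_forall fun m => Measurable.aestronglyMeasurable ?_
      refine Measurable.comp (g := box.indicator _) ?_ (by fun_prop)
      refine Measurable.indicator ?_ (MeasurableSet.univ_pi fun _ => measurableSet_Ioc)
      exact (((continuous_stepChar y).norm.pow 2).pow (m - 1)).measurable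
    · filter_upwards [eventually_ge_atTop 2] with m hm
      refine ae_of_all _ fun s => ?_
      have hm0 : (0 : ℝ) < m := by positivity
      have hr : √(m : ℝ) ^ 2 = m := Real.sq_sqrt hm0.le
      rw [← Real.exp_sum]
      simp only [hG, Set.indicator]
      split_ifs with h
      · rw [Real.norm_eq_abs, abs_of_nonneg (by positivity)]
        have ht : ∀ i, |((1 / √(m : ℝ)) • s) i| ≤ Real.pi := fun i =>
          abs_le.2 ⟨(h i (Set.mem_univ i)).1.le, (h i (Set.mem_univ i)).2⟩
        have h1 := norm_stepChar_sq_le_exp (fun i => (hy i).le) hs.le ht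
        refine (pow_le_pow_left₀ (by positivity) h1 (m - 1)).trans ?_
        rw [← Real.exp_nat_mul]
        refine Real.exp_le_exp.2 ?_
        have e : ∑ i, y i * ((1 / √(m : ℝ)) • s) i ^ 2 = (1 / m) * ∑ i, y i * s i ^ 2 := by
          rw [Finset.mul_sum]
          refine Finset.sum_congr rfl fun i _ => ?_
          rw [Pi.smul_apply, smul_eq_mul, mul_pow, div_pow, hr]
          ring
        have hS : 0 ≤ ∑ i, y i * s i ^ 2 :=
          Finset.sum_nonneg fun i _ => mul_nonneg (hy i).le (sq_nonneg _)
        have e2 : ∑ i, -(κ / 2 * y i) * s i ^ 2 = -(κ / 2) * ∑ i, y i * s i ^ 2 := by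
          rw [Finset.mul_sum]; exact Finset.sum_congr rfl fun i _ => by ring
        rw [e, e2, ← hc, ← hκ]
        -- The loss from the power `m - 1`, at most a factor `1/2` once `m ≥ 2`, explains the rate
        -- `κ / 2` in the dominating function.
        have h2 : (1 / 2 : ℝ) ≤ ((m - 1 : ℕ) : ℝ) * (1 / m) := by
          rw [Nat.cast_sub (by omega), mul_one_div, div_le_div_iff₀ two_pos hm0]
          have : (2 : ℝ) ≤ m := by exact_mod_cast hm
          push_cast; linarith
        have := mul_le_mul_of_nonneg_right h2 (mul_nonneg hκ0.le hS)
        linarith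
      · rw [norm_zero]; positivity
    · exact Integrable.fintype_prod fun i =>
        integrable_exp_neg_mul_sq (mul_pos (half_pos hκ0) (hy i))
    · refine ae_of_all _ fun s => ?_
      refine (tendsto_norm_stepChar_sq_pow y s).congr' ?_
      have h1 : ∀ i, ∀ᶠ m : ℕ in atTop,
          ((1 / √(m : ℝ)) • s) i ∈ Set.Ioc (-Real.pi) Real.pi := by
        intro i
        have : Tendsto (fun m : ℕ => ((1 / √(m : ℝ)) • s) i) atTop (𝓝 0) := by
          have h0 : Tendsto (fun m : ℕ => s i / √(m : ℝ)) atTop (𝓝 0) :=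
            tendsto_const_nhds.div_atTop
              (Real.tendsto_sqrt_atTop.comp tendsto_natCast_atTop_atTop)
          refine h0.congr fun m => ?_
          simp [div_eq_inv_mul]
        exact this.eventually (Ioc_mem_nhds (by linarith) hp)
      filter_upwards [eventually_all.2 h1] with m hm
      have : ((1 / √(m : ℝ)) • s) ∈ box := fun i _ => hm i
      simp only [hG, Set.indicator_of_mem this]
  rw [integral_exp_neg_covariance hy hs, ← hc] at hlim
  have hfin := hlim.const_mul ((1 / (2 * Real.pi)) ^ Fintype.card ι)
  have hval : (1 / (2 * Real.pi)) ^ Fintype.card ι *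
      (√Real.pi ^ Fintype.card ι / √(c * ∏ i, y i))
      = ((4 * Real.pi) ^ Fintype.card ι * c * ∏ i, y i) ^ (-(1 / 2) : ℝ) := by
    have hP : 0 < ∏ i, y i := Finset.prod_pos fun i _ => hy i
    rw [Real.rpow_neg (by positivity), ← Real.sqrt_eq_rpow, mul_assoc,
      Real.sqrt_mul (by positivity : (0 : ℝ) ≤ (4 * Real.pi) ^ Fintype.card ι),
      ← mul_div_assoc, ← mul_pow]
    have h4 : √((4 * Real.pi) ^ Fintype.card ι) = (2 * √Real.pi) ^ Fintype.card ι := by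
      rw [← Real.sqrt_sq (by positivity : 0 ≤ (2 * √Real.pi) ^ Fintype.card ι), ← pow_mul,
        mul_comm _ 2, pow_mul, mul_pow 2 (√Real.pi) 2, Real.sq_sqrt hp.le]
      norm_num
    have h5 : 1 / (2 * Real.pi) * √Real.pi = (2 * √Real.pi)⁻¹ := by
      have := Real.mul_self_sqrt hp.le
      have hr : 0 < √Real.pi := Real.sqrt_pos.2 hp
      field_simp
      nlinarith
    rw [h4, h5, inv_pow, div_eq_mul_inv, ← mul_inv]
  rw [hval] at hfin
  refine hfin.congr' ?_
  filter_upwards [eventually_gt_atTop 0] with m hm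
  have hm0 : (0 : ℝ) < m := by exact_mod_cast hm
  have hr : 0 < √(m : ℝ) := Real.sqrt_pos.2 hm0
  rw [integral_torusMeasure, ← hbox]
  simp only [hG]
  rw [Measure.integral_comp_smul, Module.finrank_fintype_fun_eq_card, smul_eq_mul, smul_eq_mul,
    abs_of_nonneg (by positivity), one_div √(m : ℝ), inv_pow √(m : ℝ), inv_inv]
  have : (m : ℝ) ^ ((Fintype.card ι : ℝ) / 2) = √m ^ Fintype.card ι := by
    rw [Real.sqrt_eq_rpow, ← Real.rpow_natCast, ← Real.rpow_mul hm0.le]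
    congr 1; ring
  rw [this]
  ring

end GaussianLimit

/-! ### The Bessel factor as a circle average -/

section Bessel

lemma integral_cos_pow_add_two (n : ℕ) :
    ∫ t, Real.cos t ^ (n + 2) ∂circleMeasure
      = ((n + 1) / (n + 2)) * ∫ t, Real.cos t ^ n ∂circleMeasure := by
  rw [integral_circleMeasure, integral_circleMeasure, integral_cos_pow]
  simp only [Real.sin_neg, Real.sin_pi, smul_eq_mul]
  ring

lemma integral_cos_pow_even (k : ℕ) :
    ∫ t, Real.cos t ^ (2 * k) ∂circleMeasure
      = ((2 * k).factorial : ℝ) / (4 ^ k * (k.factorial : ℝ) ^ 2) := by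
  induction k with
  | zero => simp
  | succ k ih =>
    have hk : (k.factorial : ℝ) ≠ 0 := by exact_mod_cast k.factorial_ne_zero
    rw [show 2 * (k + 1) = 2 * k + 2 by ring, integral_cos_pow_add_two, ih,
      Nat.factorial_succ (2 * k + 1), Nat.factorial_succ (2 * k), Nat.factorial_succ k]
    push_cast
    field_simp
    ring

lemma integral_cos_pow_odd (k : ℕ) : ∫ t, Real.cos t ^ (2 * k + 1) ∂circleMeasure = 0 := by
  induction k with
  | zero =>
    rw [integral_circleMeasure]
    simp
  | succ k ih =>
    rw [show 2 * (k + 1) + 1 = (2 * k + 1) + 2 by ring, integral_cos_pow_add_two, ih, mul_zero]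

/-- Expand the exponential and integrate term by term. Odd powers of the cosine average to zero, and
the mean `(2k)! / (4^k k!²)` of `cos^(2k)` leaves the Bessel series. -/
lemma integral_exp_mul_cos (z : ℝ) :
    ∫ t, Real.exp (z * Real.cos t) ∂circleMeasure = besselI 0 z := by
  have hint : ∀ n : ℕ, Integrable (fun t => (z * Real.cos t) ^ n / n.factorial) circleMeasure := by
    intro n
    refine Integrable.of_bound (by fun_prop) (|z| ^ n / n.factorial) (ae_of_all _ fun t => ?_)
    rw [Real.norm_eq_abs, abs_div, abs_pow, abs_mul, Nat.abs_cast]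
    gcongr
    exact mul_le_of_le_one_right (abs_nonneg _) (Real.abs_cos_le_one t)
  have hsum : Summable fun n : ℕ => ∫ t, ‖(z * Real.cos t) ^ n / n.factorial‖ ∂circleMeasure := by
    refine Summable.of_nonneg_of_le (fun n => integral_nonneg fun t => norm_nonneg _) (fun n => ?_)
      (Real.summable_pow_div_factorial |z|)
    have : ∀ t, ‖(z * Real.cos t) ^ n / n.factorial‖ ≤ |z| ^ n / n.factorial := by
      intro t
      rw [Real.norm_eq_abs, abs_div, abs_pow, abs_mul, Nat.abs_cast]
      gcongr
      exact mul_le_of_le_one_right (abs_nonneg _) (Real.abs_cos_le_one t)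
    calc _ ≤ ∫ _, |z| ^ n / n.factorial ∂circleMeasure :=
          integral_mono (hint n).norm (integrable_const _) this
      _ = _ := by simp
  have h := hasSum_integral_of_summable_integral_norm hint hsum
  have e : ∀ t, ∑' n : ℕ, (z * Real.cos t) ^ n / n.factorial = Real.exp (z * Real.cos t) := by
    intro t
    rw [Real.exp_eq_exp_ℝ, NormedSpace.exp_eq_tsum_div]
  simp only [e] at h
  have hinj : Function.Injective (fun k : ℕ => 2 * k) := fun a b hab => by simpa using hab
  rw [← hinj.hasSum_iff] at h
  · rw [← h.tsum_eq, besselI]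
    refine tsum_congr fun k => ?_
    have hk : (k.factorial : ℝ) ≠ 0 := by exact_mod_cast k.factorial_ne_zero
    have hk2 : ((2 * k).factorial : ℝ) ≠ 0 := by exact_mod_cast (2 * k).factorial_ne_zero
    simp only [Function.comp, mul_pow, mul_div_right_comm _ (Real.cos _ ^ _), integral_const_mul,
      integral_cos_pow_even, add_zero, div_pow]
    rw [show (4 : ℝ) = 2 ^ 2 by norm_num, ← pow_mul]
    field_simp
  · intro n hn
    have hodd : Odd n := by
      rw [← Nat.not_even_iff_odd]
      rintro ⟨k, hk⟩
      exact hn ⟨k, by simp only; omega⟩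
    obtain ⟨k, rfl⟩ := hodd
    simp only [mul_pow, mul_div_right_comm _ (Real.cos _ ^ _), integral_const_mul,
      integral_cos_pow_odd, mul_zero]

/-- For `l ≥ 0` the integrand is the squared modulus of the Poisson characteristic function, so the
value is the probability that two independent Poisson variables of mean `l` agree. -/
lemma integral_exp_neg_mul_one_sub_cos (l : ℝ) :
    ∫ t, Real.exp (-2 * (l * (1 - Real.cos t))) ∂circleMeasure
      = Real.exp (-2 * l) * besselI 0 (2 * l) := by
  rw [← integral_exp_mul_cos, ← integral_const_mul]
  refine integral_congr_ae (ae_of_all _ fun t => ?_)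
  simp only [← Real.exp_add]
  congr 1; ring

lemma exp_mul_besselI_nonneg (l : ℝ) : 0 ≤ Real.exp (-2 * l) * besselI 0 (2 * l) := by
  rw [← integral_exp_neg_mul_one_sub_cos]
  exact integral_nonneg fun t => (Real.exp_pos _).le

lemma exp_mul_besselI_le_one {l : ℝ} (hl : 0 ≤ l) :
    Real.exp (-2 * l) * besselI 0 (2 * l) ≤ 1 := by
  rw [← integral_exp_neg_mul_one_sub_cos]
  have h : ∀ t, Real.exp (-2 * (l * (1 - Real.cos t))) ≤ 1 := by
    intro t
    have := mul_nonneg hl (sub_nonneg.2 (Real.cos_le_one t))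
    exact Real.exp_le_one_iff.2 (by linarith)
  calc _ ≤ ∫ _, (1 : ℝ) ∂circleMeasure := by
        refine integral_mono ?_ (integrable_const _) h
        refine Integrable.of_bound (by fun_prop) 1 (ae_of_all _ fun t => ?_)
        rw [Real.norm_eq_abs, abs_of_pos (Real.exp_pos _)]
        exact h t
    _ = 1 := by simp

end Bessel

/-! ### Independence of coordinates and partial Gaussian integrals -/

lemma measurable_restrict_coord {ι : Type*} (S : Finset ι) :
    Measurable fun (t : ι → ℝ) (i : S) => t i :=
  measurable_pi_lambda _ fun _ => measurable_pi_apply _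

section Split

variable {ι : Type*} [Fintype ι]

lemma iIndepFun_eval_torusMeasure :
    iIndepFun (fun (i : ι) (t : ι → ℝ) => t i) (torusMeasure ι) :=
  iIndepFun_pi (μ := fun _ : ι => circleMeasure) (X := fun _ t => t) fun _ => aemeasurable_id

lemma map_restrict_torusMeasure (S : Finset ι) :
    (torusMeasure ι).map (fun t (i : S) => t i) = torusMeasure S := by
  have h := (iIndepFun_eval_torusMeasure (ι := ι)).precomp (g := ((↑) : S → ι))
    Subtype.val_injective
  rw [iIndepFun_iff_map_fun_eq_pi_map fun i => (measurable_pi_apply _).aemeasurable] at h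
  refine h.trans ?_
  rw [torusMeasure]
  congr 1
  funext i
  exact (measurePreserving_eval (fun _ : ι => circleMeasure) (i : ι)).map_eq

lemma integral_restrict_torusMeasure (S : Finset ι) {G : (S → ℝ) → ℝ} (hG : Measurable G) :
    ∫ t, G (fun i => t i) ∂torusMeasure ι = ∫ t, G t ∂torusMeasure S := by
  rw [← map_restrict_torusMeasure S, integral_map (measurable_restrict_coord S).aemeasurable
    hG.aestronglyMeasurable]

lemma integral_torusMeasure_mul {S T : Finset ι} (hST : Disjoint S T) {G : (S → ℝ) → ℝ}
    {H : (T → ℝ) → ℝ} (hG : Measurable G) (hH : Measurable H) :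
    ∫ t, G (fun i => t i) * H (fun i => t i) ∂torusMeasure ι
      = (∫ t, G t ∂torusMeasure S) * ∫ t, H t ∂torusMeasure T := by
  rw [← integral_restrict_torusMeasure S hG, ← integral_restrict_torusMeasure T hH]
  have h := (iIndepFun_eval_torusMeasure (ι := ι)).indepFun_finset S T hST (fun i => by fun_prop)
  exact h.integral_fun_comp_mul_comp (measurable_restrict_coord S).aemeasurable
    (measurable_restrict_coord T).aemeasurable hG.aestronglyMeasurable
    hH.aestronglyMeasurable

/-- A partial Gaussian integrated over the box. -/
lemma exists_integral_exp_neg_le (A : Finset ι) {β : ℝ} (hβ : 0 < β) :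
    ∃ K : ℝ, 0 ≤ K ∧ ∀ m : ℕ, 1 ≤ m →
      (m : ℝ) ^ ((A.card : ℝ) / 2) *
        ∫ t, Real.exp (-(β * m) * ∑ i ∈ A, t i ^ 2) ∂torusMeasure ι ≤ K := by
  classical
  refine ⟨(1 / (2 * Real.pi) * √(Real.pi / β)) ^ A.card, by positivity, fun m hm => ?_⟩
  have hp := Real.pi_pos
  have hm0 : (0 : ℝ) < m := by exact_mod_cast hm
  have e : ∀ t : ι → ℝ, Real.exp (-(β * m) * ∑ i ∈ A, t i ^ 2)
      = ∏ i, (if i ∈ A then Real.exp (-(β * m) * t i ^ 2) else 1) := by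
    intro t
    rw [Finset.mul_sum, Real.exp_sum, Finset.prod_ite_mem, Finset.univ_inter]
  simp only [e]
  rw [integral_torusMeasure_prod (fun i t => if i ∈ A then Real.exp (-(β * m) * t ^ 2) else 1)]
  have h1 : ∫ t, Real.exp (-(β * m) * t ^ 2) ∂circleMeasure
      ≤ 1 / (2 * Real.pi) * √(Real.pi / (β * m)) := by
    rw [circleMeasure, integral_smul_measure, ENNReal.toReal_ofReal (by positivity), smul_eq_mul,
      ← integral_gaussian]
    refine mul_le_mul_of_nonneg_left ?_ (by positivity)
    exact setIntegral_le_integral (integrable_exp_neg_mul_sq (by positivity))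
      (ae_of_all _ fun t => (Real.exp_pos _).le)
  have h2 : ∏ i, ∫ t, (if i ∈ A then Real.exp (-(β * m) * t ^ 2) else 1) ∂circleMeasure
      ≤ (1 / (2 * Real.pi) * √(Real.pi / (β * m))) ^ A.card := by
    have : ∀ i, ∫ t, (if i ∈ A then Real.exp (-(β * m) * t ^ 2) else 1) ∂circleMeasure
        = if i ∈ A then ∫ t, Real.exp (-(β * m) * t ^ 2) ∂circleMeasure else 1 := by
      intro i; split_ifs <;> simp
    simp only [this]
    rw [Finset.prod_ite_mem, Finset.univ_inter, Finset.prod_const]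
    exact pow_le_pow_left₀ (integral_nonneg fun t => (Real.exp_pos _).le) h1 _
  have h3 : (m : ℝ) ^ ((A.card : ℝ) / 2) = √m ^ A.card := by
    rw [Real.sqrt_eq_rpow, ← Real.rpow_natCast, ← Real.rpow_mul hm0.le]
    congr 1; ring
  refine (mul_le_mul_of_nonneg_left h2 (by positivity)).trans_eq ?_
  rw [h3, ← mul_pow, show Real.pi / (β * m) = Real.pi / β / m by rw [div_div],
    Real.sqrt_div (by positivity) (m : ℝ)]
  have hr : 0 < √(m : ℝ) := Real.sqrt_pos.2 hm0
  congr 1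
  field_simp

end Split

/-! ### Pointwise comparison of characteristic functions -/

lemma abs_norm_sub_sq_sub_le {z w : ℂ} {p q : ℝ} (hz : ‖z‖ ≤ 1) (hp : ‖1 - z‖ ≤ p)
    (hw : 0 ≤ w.re) (hq : ‖w‖ ≤ q) :
    |‖z - w‖ ^ 2 - ‖z‖ ^ 2 * Real.exp (-2 * w.re)| ≤ 2 * p * q + 3 * q ^ 2 := by
  have hwq : w.re ≤ q := (Complex.re_le_norm w).trans hq
  have hp0 : 0 ≤ p := (norm_nonneg _).trans hp
  have hq0 : 0 ≤ q := (norm_nonneg _).trans hq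
  set ρ := Real.exp (-2 * w.re) - (1 - 2 * w.re) with hρ
  have hρ0 : 0 ≤ ρ := by
    have := Real.add_one_le_exp (-2 * w.re)
    linarith
  have hρ1 : ρ ≤ 2 * q ^ 2 := by
    have h1 : Real.exp (-2 * w.re) ≤ 1 / (1 + 2 * w.re + (2 * w.re) ^ 2 / 2) := by
      rw [show -2 * w.re = -(2 * w.re) by ring, Real.exp_neg, ← one_div]
      have := Real.quadratic_le_exp_of_nonneg (show 0 ≤ 2 * w.re by linarith)
      exact one_div_le_one_div_of_le (by positivity) this
    have h2 : 1 / (1 + 2 * w.re + (2 * w.re) ^ 2 / 2) ≤ 1 - 2 * w.re + 2 * w.re ^ 2 := by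
      rw [div_le_iff₀ (by positivity)]
      nlinarith [sq_nonneg (w.re ^ 2)]
    have h3 : w.re ^ 2 ≤ q ^ 2 := pow_le_pow_left₀ hw hwq 2
    linarith
  have hz2 : ‖z‖ ^ 2 ≤ 1 := pow_le_one₀ (norm_nonneg _) hz
  have hw2 : ‖w‖ ^ 2 ≤ q ^ 2 := pow_le_pow_left₀ (norm_nonneg _) hq 2
  -- The terms linear in `w` combine to carry the factor `1 - z`, which is small near the origin and
  -- later yields a gain of `1/√m`. Everything else is of second order in `w`, `ρ` being a Taylor
  -- remainder.
  have key : ‖z - w‖ ^ 2 - ‖z‖ ^ 2 * Real.exp (-2 * w.re)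
      = -2 * ((starRingEnd ℂ) z * (1 - z) * w).re + ‖w‖ ^ 2 - ρ * ‖z‖ ^ 2 := by
    have : Real.exp (-2 * w.re) = ρ + 1 - 2 * w.re := by rw [hρ]; ring
    rw [this]
    simp only [← Complex.normSq_eq_norm_sq, Complex.normSq_apply, Complex.sub_re, Complex.sub_im,
      Complex.mul_re, Complex.mul_im, Complex.conj_re, Complex.conj_im, Complex.one_re,
      Complex.one_im]
    ring
  have h4 : |((starRingEnd ℂ) z * (1 - z) * w).re| ≤ p * q := by
    refine (Complex.abs_re_le_norm _).trans ?_
    rw [norm_mul, norm_mul, RCLike.norm_conj]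
    calc ‖z‖ * ‖1 - z‖ * ‖w‖ ≤ 1 * p * q := by gcongr
      _ = p * q := by ring
  have h5 : ρ * ‖z‖ ^ 2 ≤ 2 * q ^ 2 := by nlinarith [sq_nonneg ‖z‖]
  have h6 : 0 ≤ ρ * ‖z‖ ^ 2 := by positivity
  rw [key]
  rw [abs_le] at h4 ⊢
  constructor <;> nlinarith [sq_nonneg ‖w‖, h4.1, h4.2]

/-- Put `v' = v exp(-2W)`. The second term is `v'^(m-1) exp(-2W)`, since the exponential has `m W`
rather than `(m - 1) W`; this costs `2W`. Factoring the difference of `(m - 1)`-st powers costs `m Δ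
M^(m-2)`. -/
lemma abs_pow_sub_pow_mul_exp_le {u v W M Δ : ℝ} {m : ℕ} (hm : 1 ≤ m) (hu0 : 0 ≤ u) (huM : u ≤ M)
    (hv0 : 0 ≤ v) (hvM : v * Real.exp (-2 * W) ≤ M) (hM : M ≤ 1) (hW : 0 ≤ W)
    (hΔ : |u - v * Real.exp (-2 * W)| ≤ Δ) :
    |u ^ (m - 1) - v ^ (m - 1) * Real.exp (-2 * (m * W))| ≤ (m * Δ + 2 * W) * M ^ (m - 2) := by
  have hM0 : 0 ≤ M := hu0.trans huM
  set v' := v * Real.exp (-2 * W) with hv'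
  have hv'0 : 0 ≤ v' := by positivity
  have hΔ0 : 0 ≤ Δ := (abs_nonneg _).trans hΔ
  have e : v ^ (m - 1) * Real.exp (-2 * (m * W)) = v' ^ (m - 1) * Real.exp (-2 * W) := by
    rw [hv', mul_pow, mul_assoc, ← Real.exp_nat_mul, ← Real.exp_add, Nat.cast_sub hm]
    congr 2
    push_cast; ring
  have h1 : |u ^ (m - 1) - v' ^ (m - 1)| ≤ m * Δ * M ^ (m - 2) := by
    refine le_trans (abs_pow_sub_pow_le ..) ?_
    rw [show m - 1 - 1 = m - 2 by omega, abs_of_nonneg hu0, abs_of_nonneg hv'0, mul_comm |_|]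
    have : ((m - 1 : ℕ) : ℝ) ≤ m := by exact_mod_cast Nat.sub_le m 1
    gcongr
    exact max_le huM hvM
  have h2 : v' ^ (m - 1) ≤ M ^ (m - 2) :=
    (pow_le_pow_left₀ hv'0 hvM _).trans (pow_le_pow_of_le_one hM0 hM (by omega))
  have h3 : 0 ≤ 1 - Real.exp (-2 * W) := by
    have : Real.exp (-2 * W) ≤ 1 := Real.exp_le_one_iff.2 (by linarith)
    linarith
  have h4 : 1 - Real.exp (-2 * W) ≤ 2 * W := by
    have := Real.add_one_le_exp (-2 * W)
    linarith
  calc |u ^ (m - 1) - v ^ (m - 1) * Real.exp (-2 * (m * W))|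
      = |(u ^ (m - 1) - v' ^ (m - 1)) + v' ^ (m - 1) * (1 - Real.exp (-2 * W))| := by
        rw [e]; congr 1; ring
    _ ≤ |u ^ (m - 1) - v' ^ (m - 1)| + |v' ^ (m - 1) * (1 - Real.exp (-2 * W))| := abs_add_le _ _
    _ ≤ m * Δ * M ^ (m - 2) + M ^ (m - 2) * (2 * W) := by
        rw [abs_of_nonneg (mul_nonneg (pow_nonneg hv'0 _) h3)]
        gcongr
    _ = _ := by ring

section Core

variable {d : ℕ}

lemma sum_eq_sum_subtype_compl_add (J : Finset (Fin d)) {E : Type*} [AddCommMonoid E]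
    (g : Fin d → E) : ∑ i, g i = ∑ i : ↥Jᶜ, g i + ∑ i ∈ J, g i := by
  rw [Finset.sum_coe_sort Jᶜ g, Finset.sum_compl_add_sum]

lemma stepChar_eq_sub (J : Finset (Fin d)) (x t : Fin d → ℝ) :
    stepChar x t = stepChar (fun i : ↥Jᶜ => x i) (fun i => t i)
      - ∑ i ∈ J, x i * (1 - Complex.exp (t i * Complex.I)) := by
  rw [stepChar, stepChar, sum_eq_sum_subtype_compl_add J]
  rw [add_sub_assoc, sub_eq_add_neg, ← Finset.sum_neg_distrib]
  congr 3
  funext i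
  ring

lemma norm_one_sub_exp_le (t : ℝ) : ‖1 - Complex.exp (t * Complex.I)‖ ≤ |t| := by
  rw [norm_sub_rev, mul_comm]
  exact Real.norm_exp_I_mul_ofReal_sub_one_le

lemma norm_sum_mul_one_sub_exp_le (J : Finset (Fin d)) {x : Fin d → ℝ} (hx : ∀ i, 0 ≤ x i)
    (t : Fin d → ℝ) :
    ‖∑ i ∈ J, (x i : ℂ) * (1 - Complex.exp (t i * Complex.I))‖ ≤ 2 * ∑ i ∈ J, x i := by
  rw [Finset.mul_sum]
  refine (norm_sum_le _ _).trans (Finset.sum_le_sum fun i _ => ?_)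
  rw [norm_mul, Complex.norm_real, Real.norm_eq_abs, abs_of_nonneg (hx i), mul_comm]
  refine mul_le_mul_of_nonneg_right ?_ (hx i)
  refine (norm_sub_le _ _).trans ?_
  rw [norm_one, Complex.norm_exp_ofReal_mul_I]
  norm_num

lemma norm_one_sub_stepChar_le {ι : Type*} [Fintype ι] {y : ι → ℝ} (hy : ∀ i, 0 ≤ y i)
    (hy1 : ∀ i, y i ≤ 1) (t : ι → ℝ) : ‖1 - stepChar y t‖ ≤ ∑ i, |t i| := by
  rw [stepChar, sub_add_cancel_left, ← Finset.sum_neg_distrib]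
  refine (norm_sum_le _ _).trans (Finset.sum_le_sum fun i _ => ?_)
  rw [← mul_neg, neg_sub, norm_mul, Complex.norm_real, Real.norm_eq_abs, abs_of_nonneg (hy i)]
  calc y i * ‖1 - Complex.exp (t i * Complex.I)‖ ≤ 1 * |t i| := by
        gcongr
        · exact hy1 i
        · exact norm_one_sub_exp_le _
    _ = |t i| := one_mul _

/-- The factor `√m |s|` is at most `1 + m R`, which half of the Gaussian exponent absorbs. A factor
`|t i|` is thereby worth `1/√m`. -/
lemma sqrt_mul_abs_mul_exp_le {b m R s : ℝ} (hb : 0 < b) (hm : 0 ≤ m) (hs : s ^ 2 ≤ R) :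
    √m * |s| * Real.exp (-(b * m) * R) ≤ (1 + 2 / b) * Real.exp (-(b / 2 * m) * R) := by
  have h1 : √m * |s| ≤ 1 + m * R := by
    have h2 : (√m * |s|) ^ 2 ≤ m * R := by
      rw [mul_pow, Real.sq_sqrt hm, sq_abs]; gcongr
    nlinarith [sq_nonneg (√m * |s| - 1)]
  have hmR : 0 ≤ m * R := mul_nonneg hm ((sq_nonneg s).trans hs)
  have h3 : 1 + m * R ≤ (1 + 2 / b) * Real.exp (b / 2 * m * R) := by
    have h4 := Real.add_one_le_exp (b / 2 * m * R)
    calc 1 + m * R ≤ (1 + 2 / b) * (b / 2 * m * R + 1) := by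
          have : (1 + 2 / b) * (b / 2 * m * R + 1)
              = 1 + m * R + (2 / b + b / 2 * (m * R)) := by field_simp; ring
          rw [this]
          have : 0 ≤ 2 / b + b / 2 * (m * R) := by positivity
          linarith
      _ ≤ _ := by gcongr
  calc √m * |s| * Real.exp (-(b * m) * R)
      ≤ (1 + 2 / b) * Real.exp (b / 2 * m * R) * Real.exp (-(b * m) * R) := by
        exact mul_le_mul_of_nonneg_right (h1.trans h3) (Real.exp_pos _).le
    _ = _ := by
        rw [mul_assoc, ← Real.exp_add]
        congr 2; ring

/-- Gaussian decay, uniform in the coordinates from `J`. -/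
lemma exists_norm_stepChar_sq_le (J : Finset (Fin d)) {y : ↥Jᶜ → ℝ} (hy : ∀ i, 0 < y i)
    (hs : ∑ i, y i < 1) :
    ∃ b : ℝ, 0 < b ∧ ∀ x : Fin d → ℝ, (∀ i, 0 ≤ x i) → (∀ i : ↥Jᶜ, x i = y i) →
      ∑ i ∈ J, x i ≤ (1 - ∑ i, y i) / 2 → ∀ t : Fin d → ℝ, (∀ i, |t i| ≤ Real.pi) →
      ‖stepChar x t‖ ^ 2 ≤ Real.exp (-b * ∑ i ∈ Jᶜ, t i ^ 2) ∧
      ‖stepChar y (fun i => t i)‖ ^ 2 ≤ Real.exp (-b * ∑ i ∈ Jᶜ, t i ^ 2) := by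
  have hp := Real.pi_pos
  set c := 1 - ∑ i, y i with hc
  have hc0 : 0 < c := by linarith
  obtain ⟨ε, hε0, hε⟩ : ∃ ε : ℝ, 0 < ε ∧ ∀ i, ε ≤ y i := by
    rcases isEmpty_or_nonempty ↥Jᶜ with h | h
    · exact ⟨1, one_pos, fun i => h.elim i⟩
    · obtain ⟨i₀, hi₀⟩ := Finite.exists_min y
      exact ⟨y i₀, hy i₀, hi₀⟩
  -- Applied twice: to all coordinates of `x`, where the smallness of `∑_J x` leaves mass at least
  -- `c / 2` for not moving, and to `y` alone.
  have aux : ∀ {ι : Type} [Fintype ι] (x t : ι → ℝ) (T : ℝ), (∀ i, 0 ≤ x i) →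
      c / 2 ≤ 1 - ∑ i, x i → (∀ i, |t i| ≤ Real.pi) → ε * T ≤ ∑ i, x i * t i ^ 2 → 0 ≤ T →
      ‖stepChar x t‖ ^ 2 ≤ Real.exp (-(2 * c / Real.pi ^ 2 * ε) * T) := by
    intro ι _ x t T hx hx1 ht hT hT0
    refine (norm_stepChar_sq_le_exp hx (by linarith) ht).trans (Real.exp_le_exp.2 ?_)
    rw [neg_mul, neg_mul, neg_le_neg_iff]
    calc 2 * c / Real.pi ^ 2 * ε * T = (4 * (c / 2) / Real.pi ^ 2) * (ε * T) := by ring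
      _ ≤ _ := by
        have h0 : 0 ≤ 4 * (1 - ∑ i, x i) / Real.pi ^ 2 :=
          div_nonneg (by linarith) (sq_nonneg _)
        refine mul_le_mul ?_ hT (by positivity) h0
        gcongr
  refine ⟨2 * c / Real.pi ^ 2 * ε, by positivity, fun x hx hxy hxJ t ht => ?_⟩
  have hT0 : 0 ≤ ∑ i ∈ Jᶜ, t i ^ 2 := Finset.sum_nonneg fun i _ => sq_nonneg _
  have hTc : ε * ∑ i ∈ Jᶜ, t i ^ 2 ≤ ∑ i : ↥Jᶜ, y i * t i ^ 2 := by
    rw [← Finset.sum_coe_sort Jᶜ (fun i => t i ^ 2), Finset.mul_sum]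
    exact Finset.sum_le_sum fun i _ => mul_le_mul_of_nonneg_right (hε i) (sq_nonneg _)
  have hsum : ∑ i, x i = ∑ i, y i + ∑ i ∈ J, x i := by
    rw [sum_eq_sum_subtype_compl_add J]
    simp only [hxy]
  constructor
  · refine aux x t _ hx (by rw [hsum]; linarith) ht (hTc.trans ?_) hT0
    rw [sum_eq_sum_subtype_compl_add J]
    simp only [hxy]
    have : 0 ≤ ∑ i ∈ J, x i * t i ^ 2 :=
      Finset.sum_nonneg fun i _ => mul_nonneg (hx i) (sq_nonneg _)
    linarith
  · exact aux y _ _ (fun i => (hy i).le) (by linarith) (fun i => ht i) hTc hT0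

end Core

/-- As `R` is bounded, passing from the power `m - j` to `m` costs only a constant; truncation is
harmless because `m ≤ (m - j) + j` in any case. -/
lemma exp_pow_sub_le {b R C : ℝ} (hb : 0 ≤ b) (hR : 0 ≤ R) (hRC : R ≤ C) (m j : ℕ) :
    Real.exp (-b * R) ^ (m - j) ≤ Real.exp (j * b * C) * Real.exp (-(b * m) * R) := by
  rw [← Real.exp_nat_mul, ← Real.exp_add]
  refine Real.exp_le_exp.2 ?_
  have h1 : (m : ℝ) ≤ ((m - j : ℕ) : ℝ) + j := by exact_mod_cast le_tsub_add
  have h2 := mul_le_mul_of_nonneg_right h1 (mul_nonneg hb hR)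
  have h3 := mul_le_mul_of_nonneg_left hRC (mul_nonneg (Nat.cast_nonneg j : (0 : ℝ) ≤ j) hb)
  linarith

/-- Bookkeeping for the pointwise error: `s` is `∑_J x`, `p` bounds the factor `‖1 - z‖`, `a` is
`|Jᶜ|`, and `e₁`, `e₂` are Gaussians of rates `b` and `b / 2`. Only the term in `p` gives `1/√m`,
with factor `a`, so it disappears when `Jᶜ` is empty. -/
lemma fourier_error_le {b m r s a p W Q E e₁ e₂ : ℝ} (hb : 0 < b) (hm : 0 < m) (hr : 0 < r)
    (hs : 0 ≤ s) (ha : 0 ≤ a) (hp : 0 ≤ p) (hW : W ≤ 2 * s) (hQ : 0 ≤ Q) (hE : 0 ≤ E)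
    (he₂ : 0 ≤ e₂) (hQE : Q ≤ E * e₁)
    (hpe : p * e₁ ≤ a * (1 + 2 / b) / r * e₂) (he : e₁ ≤ e₂) :
    (m * (2 * p * (2 * s) + 3 * (2 * s) ^ 2) + 2 * W) * Q
      ≤ E * (4 * (1 + 2 / b) + 12) * ((m * s) * a / r + ((m * s) ^ 2 + m * s) / m) * e₂ := by
  have hb2 : 0 ≤ 2 / b := by positivity
  have h1 : (m * s) ^ 2 / m = m * s ^ 2 := by field_simp
  have h2 : (m * s) / m = s := by field_simp
  have h3 : 0 ≤ (m * s) * a / r := by positivity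
  have h4 : 0 ≤ m * s ^ 2 := by positivity
  calc (m * (2 * p * (2 * s) + 3 * (2 * s) ^ 2) + 2 * W) * Q
      ≤ (m * (2 * p * (2 * s) + 3 * (2 * s) ^ 2) + 2 * (2 * s)) * (E * e₁) := by
        refine mul_le_mul (by linarith) hQE hQ (by positivity)
    _ = E * (4 * (m * s) * (p * e₁) + (12 * (m * s ^ 2) + 4 * s) * e₁) := by ring
    _ ≤ E * (4 * (m * s) * (a * (1 + 2 / b) / r * e₂) + (12 * (m * s ^ 2) + 4 * s) * e₂) := by
        refine mul_le_mul_of_nonneg_left (add_le_add ?_ ?_) hE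
        · exact mul_le_mul_of_nonneg_left hpe (by positivity)
        · exact mul_le_mul_of_nonneg_left he (by positivity)
    _ = E * (4 * (1 + 2 / b) * ((m * s) * a / r) + (12 * (m * s ^ 2) + 4 * s)) * e₂ := by ring
    _ ≤ E * ((4 * (1 + 2 / b) + 12) * ((m * s) * a / r)
          + (4 * (1 + 2 / b) + 12) * (m * s ^ 2 + s)) * e₂ := by
        refine mul_le_mul_of_nonneg_right (mul_le_mul_of_nonneg_left ?_ hE) he₂
        have h5 := mul_nonneg hb2 h4
        have h6 := mul_nonneg hb2 hs
        linarith
    _ = _ := by rw [add_div, h1, h2]; ring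

/-! ### Factorization of the collision probability -/

section Core

variable {d : ℕ}

lemma sum_sq_le_card_mul (A : Finset (Fin d)) {t : Fin d → ℝ} (ht : ∀ i, |t i| ≤ Real.pi) :
    ∑ i ∈ A, t i ^ 2 ≤ d * Real.pi ^ 2 := by
  calc ∑ i ∈ A, t i ^ 2 ≤ ∑ i, t i ^ 2 :=
        Finset.sum_le_sum_of_subset_of_nonneg (Finset.subset_univ A) fun i _ _ => sq_nonneg _
    _ ≤ ∑ _i : Fin d, Real.pi ^ 2 := Finset.sum_le_sum fun i _ => by
        rw [← sq_abs]; exact pow_le_pow_left₀ (abs_nonneg _) (ht i) 2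
    _ = _ := by simp

lemma integrable_exp_neg_mul_sum_sq (A : Finset (Fin d)) {β : ℝ} (hβ : 0 ≤ β) :
    Integrable (fun t : Fin d → ℝ => Real.exp (-β * ∑ i ∈ A, t i ^ 2))
      (torusMeasure (Fin d)) := by
  refine integrable_torusMeasure_of_continuous (B := 1) (by fun_prop) fun t => ?_
  rw [Real.norm_eq_abs, abs_of_pos (Real.exp_pos _), Real.exp_le_one_iff]
  have : 0 ≤ ∑ i ∈ A, t i ^ 2 := Finset.sum_nonneg fun i _ => sq_nonneg _
  nlinarith

/-- The multinomial probabilities are `O(m ^ (-|Jᶜ| / 2))`, uniformly in the coordinates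
from `J`. -/
lemma exists_rpow_mul_multinomialProb_le (J : Finset (Fin d)) {y : ↥Jᶜ → ℝ} (hy : ∀ i, 0 < y i)
    (hs : ∑ i, y i < 1) :
    ∃ K : ℝ, 0 ≤ K ∧ ∀ m : ℕ, 1 ≤ m → ∀ x : Fin d → ℝ, (∀ i, 0 ≤ x i) →
      (∀ i : ↥Jᶜ, x i = y i) → ∑ i ∈ J, x i ≤ (1 - ∑ i, y i) / 2 →
      ∀ k ∈ indexSet d (m - 1),
        (m : ℝ) ^ ((Jᶜ.card : ℝ) / 2) * multinomialProb k (m - 1) x ≤ K := by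
  obtain ⟨b, hb, hbound⟩ := exists_norm_stepChar_sq_le J hy hs
  obtain ⟨K, hK0, hK⟩ := exists_integral_exp_neg_le Jᶜ (half_pos hb)
  set C : ℝ := d * Real.pi ^ 2
  -- The squared modulus decays at rate `b`, hence the modulus at rate `b / 2`; the exponential
  -- constant pays for the power `m - 1`.
  refine ⟨Real.exp ((1 : ℕ) * (b / 2) * C) * K, by positivity,
    fun m hm x hx hxy hxJ k hk => ?_⟩
  have hsum : ∑ i, x i ≤ 1 := by
    rw [sum_eq_sum_subtype_compl_add J]
    simp only [hxy]
    linarith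
  have h1 : ∫ t, ‖stepChar x t‖ ^ (m - 1) ∂torusMeasure (Fin d)
      ≤ ∫ t, Real.exp ((1 : ℕ) * (b / 2) * C) * Real.exp (-(b / 2 * m) * ∑ i ∈ Jᶜ, t i ^ 2)
        ∂torusMeasure (Fin d) := by
    refine integral_mono_ae ?_
      ((integrable_exp_neg_mul_sum_sq Jᶜ (by positivity)).const_mul _) ?_
    · refine integrable_torusMeasure_of_continuous (B := 1) (by fun_prop) fun t => ?_
      rw [norm_pow, norm_norm]
      exact pow_le_one₀ (norm_nonneg _) (norm_stepChar_le_one hx hsum t)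
    · filter_upwards [ae_torusMeasure] with t ht
      have hR0 : 0 ≤ ∑ i ∈ Jᶜ, t i ^ 2 := Finset.sum_nonneg fun i _ => sq_nonneg _
      refine le_trans ?_ (exp_pow_sub_le (half_pos hb).le hR0 (sum_sq_le_card_mul Jᶜ ht) m 1)
      refine pow_le_pow_left₀ (norm_nonneg _) ?_ _
      refine (sq_le_sq₀ (norm_nonneg _) (Real.exp_pos _).le).1
        ((hbound x hx hxy hxJ t ht).1.trans_eq ?_)
      rw [← Real.exp_nat_mul]
      congr 1; push_cast; ring
  calc _ ≤ (m : ℝ) ^ ((Jᶜ.card : ℝ) / 2) * ∫ t, Real.exp ((1 : ℕ) * (b / 2) * C)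
        * Real.exp (-(b / 2 * m) * ∑ i ∈ Jᶜ, t i ^ 2) ∂torusMeasure (Fin d) := by
        gcongr
        exact (multinomialProb_le_integral hx hk).trans h1
    _ = Real.exp ((1 : ℕ) * (b / 2) * C) * ((m : ℝ) ^ ((Jᶜ.card : ℝ) / 2) *
          ∫ t, Real.exp (-(b / 2 * m) * ∑ i ∈ Jᶜ, t i ^ 2) ∂torusMeasure (Fin d)) := by
        rw [integral_const_mul]; ring
    _ ≤ _ := by gcongr; exact hK m hm

/-- The sum of the squared multinomial probabilities factorizes, up to an explicit error, into the
contributions of the coordinates outside `J` and of a Poisson distribution on `J`. -/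
theorem exists_abs_rpow_mul_sum_sq_sub_le (J : Finset (Fin d)) {y : ↥Jᶜ → ℝ}
    (hy : ∀ i, 0 < y i) (hs : ∑ i, y i < 1) :
    ∃ K : ℝ, 0 ≤ K ∧ ∀ m : ℕ, 1 ≤ m → ∀ x : Fin d → ℝ, (∀ i, 0 ≤ x i) →
      (∀ i : ↥Jᶜ, x i = y i) → ∑ i ∈ J, x i ≤ (1 - ∑ i, y i) / 2 →
      |(m : ℝ) ^ ((Jᶜ.card : ℝ) / 2) * ∑ k ∈ indexSet d (m - 1), multinomialProb k (m - 1) x ^ 2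
        - ((m : ℝ) ^ ((Jᶜ.card : ℝ) / 2) *
            ∫ t, (‖stepChar y t‖ ^ 2) ^ (m - 1) ∂torusMeasure ↥Jᶜ) *
          ∏ i : ↥J, (Real.exp (-2 * (m * x i)) * besselI 0 (2 * (m * x i)))|
      ≤ K * ((m * ∑ i ∈ J, x i) * Jᶜ.card / √m
          + ((m * ∑ i ∈ J, x i) ^ 2 + m * ∑ i ∈ J, x i) / m) := by
  obtain ⟨b, hb, hbound⟩ := exists_norm_stepChar_sq_le J hy hs
  obtain ⟨K, hK0, hK⟩ := exists_integral_exp_neg_le Jᶜ (half_pos hb)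
  set C : ℝ := d * Real.pi ^ 2
  -- Pays for the power `m - 2` left after comparing `(m - 1)`-st powers.
  set E₀ : ℝ := Real.exp ((2 : ℕ) * b * C)
  refine ⟨E₀ * (4 * (1 + 2 / b) + 12) * K, by positivity, fun m hm x hx hxy hxJ => ?_⟩
  have hm0 : (0 : ℝ) < m := by exact_mod_cast hm
  have hr : 0 < √(m : ℝ) := Real.sqrt_pos.2 hm0
  have hrr : √(m : ℝ) ^ 2 = m := Real.sq_sqrt hm0.le
  have hsum : ∑ i, x i ≤ 1 := by
    rw [sum_eq_sum_subtype_compl_add J]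
    simp only [hxy]
    linarith
  have hy1 : ∀ i, y i ≤ 1 := fun i =>
    (Finset.single_le_sum (fun j _ => (hy j).le) (Finset.mem_univ i)).trans hs.le
  set s := ∑ i ∈ J, x i with hs_def
  have hs0 : 0 ≤ s := Finset.sum_nonneg fun i _ => hx i
  set err := (m * s) * Jᶜ.card / √m + ((m * s) ^ 2 + m * s) / m with herr
  have herr0 : 0 ≤ err := by positivity
  -- `G` and `H` see disjoint sets of coordinates, so the integral of their product splits, and `H`
  -- integrates to the Bessel product.
  set G : (↥Jᶜ → ℝ) → ℝ := fun t => (‖stepChar y t‖ ^ 2) ^ (m - 1) with hG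
  set H : (↥J → ℝ) → ℝ := fun t => ∏ i : ↥J, Real.exp (-2 * ((m * x i) * (1 - Real.cos (t i)))) with hH
  have hGm : Continuous G := ((continuous_stepChar y).norm.pow 2).pow (m - 1)
  have hHm : Continuous H := by rw [hH]; fun_prop
  have hHint : ∏ i : ↥J, (Real.exp (-2 * (m * x i)) * besselI 0 (2 * (m * x i)))
      = ∫ t, H t ∂torusMeasure ↥J := by
    rw [hH, integral_torusMeasure_prod
      (fun (i : ↥J) t => Real.exp (-2 * ((m * x i) * (1 - Real.cos t))))]
    simp only [integral_exp_neg_mul_one_sub_cos]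
  have hprod := integral_torusMeasure_mul (disjoint_compl_left : Disjoint Jᶜ J) hGm.measurable
    hHm.measurable
  have hpt : ∀ t : Fin d → ℝ, (∀ i, |t i| ≤ Real.pi) →
      |(‖stepChar x t‖ ^ 2) ^ (m - 1) - G (fun i => t i) * H (fun i => t i)|
        ≤ E₀ * (4 * (1 + 2 / b) + 12) * err * Real.exp (-(b / 2 * m) * ∑ i ∈ Jᶜ, t i ^ 2) := by
    intro t ht
    obtain ⟨hu, hv⟩ := hbound x hx hxy hxJ t ht
    set R := ∑ i ∈ Jᶜ, t i ^ 2 with hR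
    have hR0 : 0 ≤ R := Finset.sum_nonneg fun i _ => sq_nonneg _
    set w : ℂ := ∑ i ∈ J, x i * (1 - Complex.exp (t i * Complex.I)) with hw
    set p := ∑ i : ↥Jᶜ, |t i| with hp
    have hw_re : w.re = ∑ i ∈ J, x i * (1 - Real.cos (t i)) := by
      simp [hw, Complex.re_sum, Complex.exp_ofReal_mul_I_re]
    have hw0 : 0 ≤ w.re := by
      rw [hw_re]
      exact Finset.sum_nonneg fun i _ => mul_nonneg (hx i) (sub_nonneg.2 (Real.cos_le_one _))
    have hwn : ‖w‖ ≤ 2 * s := norm_sum_mul_one_sub_exp_le J hx t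
    have hws : w.re ≤ 2 * s := (Complex.re_le_norm w).trans hwn
    have hstep : stepChar x t = stepChar y (fun i => t i) - w := by
      rw [stepChar_eq_sub J]
      simp only [hxy, ← hw]
    have hHt : H (fun i => t i) = Real.exp (-2 * (m * w.re)) := by
      simp only [hH]
      rw [← Real.exp_sum, hw_re, Finset.mul_sum, Finset.mul_sum,
        Finset.sum_coe_sort J (fun i => -2 * (m * x i * (1 - Real.cos (t i))))]
      simp only [mul_assoc]
    have hΔ := abs_norm_sub_sq_sub_le (norm_stepChar_le_one (fun i => (hy i).le) hs.le _)
      (norm_one_sub_stepChar_le (fun i => (hy i).le) hy1 fun i => t i) hw0 hwn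
    rw [← hstep] at hΔ
    have hM1 : Real.exp (-b * R) ≤ 1 := Real.exp_le_one_iff.2 (by nlinarith)
    have hvM : ‖stepChar y (fun i => t i)‖ ^ 2 * Real.exp (-2 * w.re) ≤ Real.exp (-b * R) := by
      refine (mul_le_of_le_one_right (sq_nonneg _) ?_).trans hv
      exact Real.exp_le_one_iff.2 (by linarith)
    have hmain := abs_pow_sub_pow_mul_exp_le hm (sq_nonneg _) hu (sq_nonneg _) hvM hM1 hw0 hΔ
    rw [hHt]
    refine hmain.trans ?_
    have hpow := exp_pow_sub_le hb.le hR0 (sum_sq_le_card_mul Jᶜ ht) m 2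
    have hp0 : 0 ≤ p := Finset.sum_nonneg fun i _ => abs_nonneg _
    have hpe : p * Real.exp (-(b * m) * R)
        ≤ Jᶜ.card * (1 + 2 / b) / √m * Real.exp (-(b / 2 * m) * R) := by
      have h1 : ∀ i : ↥Jᶜ, |t i| * Real.exp (-(b * m) * R)
          ≤ (1 + 2 / b) / √m * Real.exp (-(b / 2 * m) * R) := by
        intro i
        have h2 : t i ^ 2 ≤ R :=
          Finset.single_le_sum (f := fun i => t i ^ 2) (fun j _ => sq_nonneg _) i.2
        have h3 := sqrt_mul_abs_mul_exp_le hb hm0.le h2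
        rw [div_mul_eq_mul_div, le_div_iff₀ hr]
        linarith
      rw [hp, Finset.sum_mul]
      refine (Finset.sum_le_sum fun i _ => h1 i).trans_eq ?_
      rw [Finset.sum_const, Finset.card_univ, Fintype.card_coe, nsmul_eq_mul]
      ring
    have hexp : Real.exp (-(b * m) * R) ≤ Real.exp (-(b / 2 * m) * R) := by
      refine Real.exp_le_exp.2 ?_
      have : 0 ≤ b * m * R := by positivity
      linarith
    set e₁ := Real.exp (-(b * m) * R)
    set e₂ := Real.exp (-(b / 2 * m) * R) with he₂
    have he₂0 : 0 ≤ e₂ := (Real.exp_pos _).le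
    exact fourier_error_le hb hm0 hr hs0 (Nat.cast_nonneg _) hp0 hws
      (pow_nonneg (Real.exp_pos _).le _) (Real.exp_pos _).le he₂0 hpow hpe hexp
  have hI1 : Integrable (fun t => (‖stepChar x t‖ ^ 2) ^ (m - 1)) (torusMeasure (Fin d)) := by
    refine integrable_torusMeasure_of_continuous (B := 1) (by fun_prop) fun t => ?_
    rw [norm_pow, norm_pow, norm_norm]
    exact pow_le_one₀ (by positivity)
      (pow_le_one₀ (norm_nonneg _) (norm_stepChar_le_one hx hsum t))
  have hI2 : Integrable (fun t : Fin d → ℝ => G (fun i => t i) * H (fun i => t i))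
      (torusMeasure (Fin d)) := by
    refine integrable_torusMeasure_of_continuous (B := 1) ?_ fun t => ?_
    · exact (hGm.comp (by fun_prop)).mul (hHm.comp (by fun_prop))
    · have hG1 : G (fun i => t i) ≤ 1 := pow_le_one₀ (by positivity)
        (pow_le_one₀ (norm_nonneg _) (norm_stepChar_le_one (fun i => (hy i).le) hs.le _))
      have hG0 : 0 ≤ G (fun i => t i) := by positivity
      have hH1 : H (fun i => t i) ≤ 1 := by
        refine Finset.prod_le_one (fun i _ => (Real.exp_pos _).le) fun i _ => ?_
        have := mul_nonneg (mul_nonneg hm0.le (hx i)) (sub_nonneg.2 (Real.cos_le_one (t i)))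
        exact Real.exp_le_one_iff.2 (by linarith)
      have hH0 : 0 ≤ H (fun i => t i) := Finset.prod_nonneg fun i _ => (Real.exp_pos _).le
      rw [Real.norm_eq_abs, abs_of_nonneg (mul_nonneg hG0 hH0)]
      exact mul_le_one₀ hG1 hH0 hH1
  rw [sum_multinomialProb_sq hx hsum, hHint, mul_assoc, ← hprod, ← mul_sub,
    ← integral_sub hI1 hI2, abs_mul, abs_of_nonneg (by positivity)]
  have hfin : |∫ t, ((‖stepChar x t‖ ^ 2) ^ (m - 1) - G (fun i => t i) * H (fun i => t i))
      ∂torusMeasure (Fin d)| ≤ E₀ * (4 * (1 + 2 / b) + 12) * err *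
        ∫ t, Real.exp (-(b / 2 * m) * ∑ i ∈ Jᶜ, t i ^ 2) ∂torusMeasure (Fin d) := by
    rw [← integral_const_mul]
    refine (abs_integral_le_integral_abs).trans (integral_mono_ae (hI1.sub hI2).abs
      ((integrable_exp_neg_mul_sum_sq Jᶜ (by positivity)).const_mul _) ?_)
    filter_upwards [ae_torusMeasure] with t ht using hpt t ht
  calc _ ≤ (m : ℝ) ^ ((Jᶜ.card : ℝ) / 2) * (E₀ * (4 * (1 + 2 / b) + 12) * err *
        ∫ t, Real.exp (-(b / 2 * m) * ∑ i ∈ Jᶜ, t i ^ 2) ∂torusMeasure (Fin d)) := by gcongr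
    _ = E₀ * (4 * (1 + 2 / b) + 12) * ((m : ℝ) ^ ((Jᶜ.card : ℝ) / 2) *
        ∫ t, Real.exp (-(b / 2 * m) * ∑ i ∈ Jᶜ, t i ^ 2) ∂torusMeasure (Fin d)) * err := by ring
    _ ≤ _ := by gcongr; exact hK m hm

end Core

/-! ### The density, its regularity and the cell masses -/

section Density

variable {d : ℕ}

lemma sum_le_one_of_mem_simplex {x : Fin d → ℝ} (hx : x ∈ simplex d) : ∑ i, x i ≤ 1 :=
  (Finset.sum_le_sum fun i _ => le_abs_self (x i)).trans hx.2

lemma mem_simplex_iff {x : Fin d → ℝ} : x ∈ simplex d ↔ (∀ i, 0 ≤ x i) ∧ ∑ i, x i ≤ 1 := by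
  constructor
  · exact fun h => ⟨fun i => (h.1 i).1, sum_le_one_of_mem_simplex h⟩
  · rintro ⟨h0, h1⟩
    refine ⟨fun i => ⟨h0 i, ?_⟩, by simpa only [abs_of_nonneg (h0 _)] using h1⟩
    exact (Finset.single_le_sum (fun j _ => h0 j) (Finset.mem_univ i)).trans h1

lemma zeroOn_mem_simplex (J : Finset (Fin d)) {x : Fin d → ℝ} (hx : x ∈ simplex d) :
    zeroOn J x ∈ simplex d := by
  rw [mem_simplex_iff] at hx ⊢
  constructor
  · intro i
    simp only [zeroOn]
    split_ifs
    exacts [le_rfl, hx.1 i]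
  · refine (Finset.sum_le_sum fun i _ => ?_).trans hx.2
    simp only [zeroOn]
    split_ifs
    exacts [hx.1 i, le_rfl]

lemma isCompact_simplex : IsCompact (simplex d) := by
  have h : simplex d = (Set.univ.pi fun _ => Set.Icc (0 : ℝ) 1) ∩ {x | ∑ i, |x i| ≤ 1} := by
    ext x
    simp only [simplex, Set.mem_inter_iff, Set.mem_univ_pi, Set.mem_ofPred_eq]
  rw [h]
  exact (isCompact_univ_pi fun _ => isCompact_Icc).inter_right
    (isClosed_le (by fun_prop) continuous_const)

lemma convex_simplex : Convex ℝ (simplex d) := by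
  intro x hx y hy a b ha hb hab
  rw [mem_simplex_iff] at *
  refine ⟨fun i => add_nonneg (mul_nonneg ha (hx.1 i)) (mul_nonneg hb (hy.1 i)), ?_⟩
  simp only [Pi.add_apply, Pi.smul_apply, smul_eq_mul, Finset.sum_add_distrib, ← Finset.mul_sum]
  calc a * ∑ i, x i + b * ∑ i, y i ≤ a * 1 + b * 1 := by gcongr; exacts [hx.2, hy.2]
    _ = 1 := by linarith

/-- A `C¹` function on a compact convex set is Lipschitz, and the sup distance is at most the `ℓ¹`
distance. Together with boundedness, this is all the regularity of `f` that the variance expansion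
uses. -/
lemma IsC2OnSimplex.exists_lipschitz {f : (Fin d → ℝ) → ℝ} (hf : IsC2OnSimplex f) :
    ∃ L : ℝ, 0 ≤ L ∧ ∀ u ∈ simplex d, ∀ v ∈ simplex d, |f u - f v| ≤ L * ∑ i, |u i - v i| := by
  obtain ⟨-, U, g, -, hsU, hgf, hg⟩ := hf
  obtain ⟨K, hK⟩ := (hg.mono hsU).exists_lipschitzOnWith (by norm_num) convex_simplex
    isCompact_simplex
  refine ⟨K, K.2, fun u hu v hv => ?_⟩
  rw [← hgf hu, ← hgf hv, ← Real.dist_eq]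
  refine (hK.dist_le_mul u hu v hv).trans (mul_le_mul_of_nonneg_left ?_ K.2)
  refine (dist_pi_le_iff (Finset.sum_nonneg fun i _ => abs_nonneg _)).2 fun i => ?_
  rw [Real.dist_eq]
  exact Finset.single_le_sum (f := fun i => |u i - v i|) (fun j _ => abs_nonneg _)
    (Finset.mem_univ i)

lemma IsSimplexDensity.exists_le {f : (Fin d → ℝ) → ℝ} (hf : IsSimplexDensity f)
    (hf2 : IsC2OnSimplex f) : ∃ B : ℝ, 0 ≤ B ∧ ∀ v, f v ≤ B := by
  obtain ⟨-, U, g, -, hsU, hgf, hg⟩ := hf2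
  obtain ⟨B, hB⟩ := isCompact_simplex.exists_bound_of_continuousOn (hg.continuousOn.mono hsU)
  refine ⟨max B 0, le_max_right _ _, fun v => ?_⟩
  by_cases hv : v ∈ simplex d
  · rw [← hgf hv]
    exact (le_abs_self _).trans ((hB v hv).trans (le_max_left _ _))
  · rw [hf.eq_zero v hv]
    exact le_max_right _ _

/-- A Lipschitz estimate around a point `x` with `∑ x i ≤ 1 - c`, valid also for points outside
the simplex, where the density vanishes. -/
lemma IsSimplexDensity.abs_sub_le {f : (Fin d → ℝ) → ℝ} (hf : IsSimplexDensity f) {L B c : ℝ}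
    (hL0 : 0 ≤ L) (hB0 : 0 ≤ B) (hc : 0 < c)
    (hL : ∀ u ∈ simplex d, ∀ v ∈ simplex d, |f u - f v| ≤ L * ∑ i, |u i - v i|)
    (hB : ∀ v, f v ≤ B) {x v : Fin d → ℝ} (hx : x ∈ simplex d) (hxc : ∑ i, x i ≤ 1 - c)
    (hv : ∀ i, 0 ≤ v i) : |f v - f x| ≤ (L + B / c) * ∑ i, |v i - x i| := by
  have hS : 0 ≤ ∑ i, |v i - x i| := Finset.sum_nonneg fun i _ => abs_nonneg _
  have hBc : 0 ≤ B / c := by positivity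
  rw [add_mul]
  by_cases hvs : v ∈ simplex d
  · linarith [hL v hvs x hx, mul_nonneg hBc hS]
  · have h1 : 1 < ∑ i, v i := by
      by_contra! h
      exact hvs (mem_simplex_iff.2 ⟨hv, h⟩)
    -- Cells may stick out of the simplex. A point outside it is at `ℓ¹` distance at least `c` from
    -- `x`, so the trivial bound `B` is already linear in the distance.
    have h2 : c ≤ ∑ i, |v i - x i| := by
      have : ∑ i, (v i - x i) ≤ ∑ i, |v i - x i| := Finset.sum_le_sum fun i _ => le_abs_self _
      rw [Finset.sum_sub_distrib] at this
      linarith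
    rw [hf.eq_zero v hvs, zero_sub, abs_neg, abs_of_nonneg (hf.nonneg x)]
    have h3 : B ≤ B / c * ∑ i, |v i - x i| := by
      rw [div_mul_eq_mul_div, le_div_iff₀ hc]
      exact mul_le_mul_of_nonneg_left h2 hB0
    linarith [hB x, mul_nonneg hL0 hS]

/-- The probability measure with density `f`. -/
noncomputable def densityMeasure (f : (Fin d → ℝ) → ℝ) : Measure (Fin d → ℝ) :=
  volume.withDensity fun y => ENNReal.ofReal (f y)

lemma IsSimplexDensity.isProbabilityMeasure {f : (Fin d → ℝ) → ℝ} (hf : IsSimplexDensity f) :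
    IsProbabilityMeasure (densityMeasure f) :=
  ⟨by rw [densityMeasure, withDensity_apply _ .univ, Measure.restrict_univ, hf.lintegral_eq_one]⟩

lemma IsSimplexDensity.integrable {f : (Fin d → ℝ) → ℝ} (hf : IsSimplexDensity f) :
    Integrable f := by
  refine ⟨hf.measurable.aestronglyMeasurable, ?_⟩
  rw [hasFiniteIntegral_iff_ofReal (ae_of_all _ hf.nonneg), hf.lintegral_eq_one]
  exact ENNReal.one_lt_top

lemma measurableSet_cell (m : ℕ) (k : Fin d → ℕ) : MeasurableSet (cell m k) :=
  MeasurableSet.univ_pi fun _ => measurableSet_Ioc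

lemma IsSimplexDensity.measureReal_cell {f : (Fin d → ℝ) → ℝ} (hf : IsSimplexDensity f) (m : ℕ)
    (k : Fin d → ℕ) : (densityMeasure f).real (cell m k) = ∫ v in cell m k, f v := by
  rw [measureReal_def, densityMeasure, withDensity_apply _ (measurableSet_cell m k),
    integral_eq_lintegral_of_nonneg_ae (ae_of_all _ hf.nonneg)
      hf.measurable.aestronglyMeasurable.restrict]

lemma volume_real_cell {m : ℕ} (hm : 1 ≤ m) (k : Fin d → ℕ) :
    (volume : Measure (Fin d → ℝ)).real (cell m k) = ((m : ℝ) ^ d)⁻¹ := by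
  have hm0 : (0 : ℝ) < m := by exact_mod_cast hm
  rw [measureReal_def, cell, volume_pi, Measure.pi_pi]
  simp only [Real.volume_Ioc]
  have : ∀ i, ((k i : ℝ) + 1) / m - k i / m = 1 / m := fun i => by ring
  simp only [this, Finset.prod_const, Finset.card_univ, Fintype.card_fin, ENNReal.toReal_pow]
  rw [ENNReal.toReal_ofReal (by positivity)]
  simp

lemma volume_cell_ne_top (m : ℕ) (k : Fin d → ℕ) :
    (volume : Measure (Fin d → ℝ)) (cell m k) ≠ ⊤ := by
  rw [cell, volume_pi, Measure.pi_pi]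
  exact ENNReal.prod_ne_top fun i _ => by simp [Real.volume_Ioc]

lemma sum_abs_sub_le_of_mem_cell {m : ℕ} {k : Fin d → ℕ} {v : Fin d → ℝ}
    (hv : v ∈ cell m k) (x : Fin d → ℝ) :
    ∑ i, |v i - x i| ≤ ∑ i, |(k i : ℝ) / m - x i| + d / m := by
  have h : ∀ i, |v i - x i| ≤ |(k i : ℝ) / m - x i| + 1 / m := by
    intro i
    obtain ⟨h1, h2⟩ := hv i (Set.mem_univ i)
    rw [add_div] at h2
    calc |v i - x i| = |((k i : ℝ) / m - x i) + (v i - k i / m)| := by congr 1; ring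
      _ ≤ |(k i : ℝ) / m - x i| + |v i - k i / m| := abs_add_le _ _
      _ ≤ _ := by
          gcongr
          rw [abs_of_nonneg (by linarith)]
          linarith
  refine (Finset.sum_le_sum fun i _ => h i).trans_eq ?_
  rw [Finset.sum_add_distrib, Finset.sum_const, Finset.card_univ, Fintype.card_fin, nsmul_eq_mul]
  ring

lemma IsSimplexDensity.pow_mul_measureReal_cell_le {f : (Fin d → ℝ) → ℝ}
    (hf : IsSimplexDensity f) {B : ℝ} (hB : ∀ v, f v ≤ B) {m : ℕ} (hm : 1 ≤ m) (k : Fin d → ℕ) :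
    (m : ℝ) ^ d * (densityMeasure f).real (cell m k) ≤ B := by
  have hm0 : (0 : ℝ) < (m : ℝ) ^ d := by positivity
  rw [hf.measureReal_cell]
  have h : ∫ v in cell m k, f v ≤ ∫ _ in cell m k, B :=
    setIntegral_mono hf.integrable.integrableOn
      (integrableOn_const (volume_cell_ne_top m k)) fun v => hB v
  rw [setIntegral_const, volume_real_cell hm, smul_eq_mul] at h
  calc _ ≤ (m : ℝ) ^ d * (((m : ℝ) ^ d)⁻¹ * B) := by gcongr
    _ = B := by field_simp

/-- Since `m ^ d` is the inverse volume of a cell, the rescaled mass is an average of `f` over the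
cell, and the Lipschitz estimate applies under the integral. -/
lemma IsSimplexDensity.abs_pow_mul_measureReal_cell_sub_le {f : (Fin d → ℝ) → ℝ}
    (hf : IsSimplexDensity f) {L B c : ℝ} (hL0 : 0 ≤ L) (hB0 : 0 ≤ B) (hc : 0 < c)
    (hL : ∀ u ∈ simplex d, ∀ v ∈ simplex d, |f u - f v| ≤ L * ∑ i, |u i - v i|)
    (hB : ∀ v, f v ≤ B) {x : Fin d → ℝ} (hx : x ∈ simplex d) (hxc : ∑ i, x i ≤ 1 - c)
    {m : ℕ} (hm : 1 ≤ m) (k : Fin d → ℕ) :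
    |(m : ℝ) ^ d * (densityMeasure f).real (cell m k) - f x|
      ≤ (L + B / c) * (∑ i, |(k i : ℝ) / m - x i| + d / m) := by
  have hm0 : (0 : ℝ) < (m : ℝ) ^ d := by positivity
  have hLB : 0 ≤ L + B / c := by positivity
  set D := (L + B / c) * (∑ i, |(k i : ℝ) / m - x i| + d / m)
  have h1 : ‖∫ v in cell m k, (f v - f x)‖ ≤ D * (volume : Measure (Fin d → ℝ)).real (cell m k) := by
    refine norm_setIntegral_le_of_norm_le_const (volume_cell_ne_top m k).lt_top fun v hv => ?_
    have hv0 : ∀ i, 0 ≤ v i := fun i =>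
      (show (0 : ℝ) ≤ k i / m by positivity).trans (hv i (Set.mem_univ i)).1.le
    refine (hf.abs_sub_le hL0 hB0 hc hL hB hx hxc hv0).trans ?_
    exact mul_le_mul_of_nonneg_left (sum_abs_sub_le_of_mem_cell hv x) hLB
  rw [integral_sub hf.integrable.integrableOn (integrableOn_const (volume_cell_ne_top m k)),
    setIntegral_const, volume_real_cell hm, smul_eq_mul, ← hf.measureReal_cell,
    Real.norm_eq_abs] at h1
  have h2 := mul_le_mul_of_nonneg_left h1 hm0.le
  rw [← abs_of_pos hm0, ← abs_mul, abs_of_pos hm0, mul_sub] at h2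
  have e1 : (m : ℝ) ^ d * (((m : ℝ) ^ d)⁻¹ * f x) = f x := by field_simp
  have e2 : (m : ℝ) ^ d * (D * ((m : ℝ) ^ d)⁻¹) = D := by field_simp
  rwa [e1, e2] at h2

end Density

/-! ### Exact variance of the estimator -/

section Variance

variable {d : ℕ}

lemma eq_of_mem_cell {m : ℕ} (hm : 1 ≤ m) {k l : Fin d → ℕ} {v : Fin d → ℝ}
    (hk : v ∈ cell m k) (hl : v ∈ cell m l) : k = l := by
  have hm0 : (0 : ℝ) < m := by exact_mod_cast hm
  have aux : ∀ {k l : Fin d → ℕ}, v ∈ cell m k → v ∈ cell m l → ∀ i, k i ≤ l i := by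
    intro k l hk hl i
    have h := (hk i (Set.mem_univ i)).1.trans_le (hl i (Set.mem_univ i)).2
    rw [div_lt_div_iff_of_pos_right hm0] at h
    exact Nat.lt_succ_iff.1 (by exact_mod_cast h)
  exact funext fun i => le_antisymm (aux hk hl i) (aux hl hk i)

/-- Distinct cells are disjoint, so all cross terms vanish; this makes the second moment a single
sum. -/
lemma sum_mul_indicator_cell_sq {m : ℕ} (hm : 1 ≤ m) (S : Finset (Fin d → ℕ))
    (c : (Fin d → ℕ) → ℝ) (v : Fin d → ℝ) :
    (∑ k ∈ S, c k * (cell m k).indicator (fun _ => (1 : ℝ)) v) ^ 2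
      = ∑ k ∈ S, c k ^ 2 * (cell m k).indicator (fun _ => (1 : ℝ)) v := by
  rw [sq, Finset.sum_mul_sum]
  refine Finset.sum_congr rfl fun k hk => ?_
  rw [Finset.sum_eq_single k]
  · by_cases h : v ∈ cell m k
    · simp [h, sq]
    · simp [h]
  · intro l _ hlk
    by_cases h : v ∈ cell m k
    · have : v ∉ cell m l := fun h' => hlk (eq_of_mem_cell hm h' h)
      simp [this]
    · simp [h]
  · exact fun h => absurd hk h

lemma variance_sum_mul_indicator_cell {m : ℕ} (hm : 1 ≤ m) (S : Finset (Fin d → ℕ))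
    (c : (Fin d → ℕ) → ℝ) (μ : Measure (Fin d → ℝ)) [IsProbabilityMeasure μ] :
    variance (fun v => ∑ k ∈ S, c k * (cell m k).indicator (fun _ => (1 : ℝ)) v) μ
      = ∑ k ∈ S, c k ^ 2 * μ.real (cell m k) - (∑ k ∈ S, c k * μ.real (cell m k)) ^ 2 := by
  have hi : ∀ k, Integrable ((cell m k).indicator fun _ => (1 : ℝ)) μ := fun k =>
    (integrable_const 1).indicator (measurableSet_cell m k)
  have hint : ∀ c : (Fin d → ℕ) → ℝ,
      ∫ v, ∑ k ∈ S, c k * (cell m k).indicator (fun _ => (1 : ℝ)) v ∂μ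
        = ∑ k ∈ S, c k * μ.real (cell m k) := by
    intro c
    rw [integral_finsetSum _ fun k _ => (hi k).const_mul _]
    refine Finset.sum_congr rfl fun k _ => ?_
    rw [integral_const_mul, integral_indicator_const _ (measurableSet_cell m k), smul_eq_mul,
      mul_one]
  have hL2 : MemLp (fun v => ∑ k ∈ S, c k * (cell m k).indicator (fun _ => (1 : ℝ)) v) 2 μ := by
    refine memLp_finsetSum _ fun k _ => ?_
    exact (memLp_indicator_const 2 (measurableSet_cell m k) 1 (Or.inr (measure_ne_top _ _))).const_mul _
  rw [variance_eq_sub hL2]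
  simp only [Pi.pow_apply, sum_mul_indicator_cell_sq hm, hint]

/-- The exact variance of the density estimator. -/
theorem variance_densityEstimator {f : (Fin d → ℝ) → ℝ} (hf : IsSimplexDensity f) {m n : ℕ}
    (hm : 1 ≤ m) (hn : 1 ≤ n) (x : Fin d → ℝ) {Ω : Type*} [MeasurableSpace Ω] (P : Measure Ω)
    [IsProbabilityMeasure P] (X : Fin n → Ω → Fin d → ℝ) (hX : iIndepFun X P)
    (hlaw : ∀ j, HasLaw (X j) (densityMeasure f) P) :
    variance (fun ω => densityEstimator m (fun j => X j ω) x) P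
      = (n : ℝ)⁻¹ * (m : ℝ) ^ (2 * d) *
        (∑ k ∈ indexSet d (m - 1),
            (densityMeasure f).real (cell m k) * multinomialProb k (m - 1) x ^ 2
          - (∑ k ∈ indexSet d (m - 1),
            (densityMeasure f).real (cell m k) * multinomialProb k (m - 1) x) ^ 2) := by
  have := hf.isProbabilityMeasure
  have hn0 : (0 : ℝ) < n := by exact_mod_cast hn
  -- The estimator is the mean of the independent variables `h (X j)`.
  set h : (Fin d → ℝ) → ℝ := fun v => ∑ k ∈ indexSet d (m - 1),
    ((m : ℝ) ^ d * multinomialProb k (m - 1) x) * (cell m k).indicator (fun _ => (1 : ℝ)) v with hh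
  have hmeas : Measurable h := by
    refine Finset.measurable_fun_sum _ fun k _ => Measurable.const_mul ?_ _
    exact measurable_const.indicator (measurableSet_cell m k)
  have hL2 : MemLp h 2 (densityMeasure f) := by
    refine memLp_finsetSum _ fun k _ => ?_
    exact (memLp_indicator_const 2 (measurableSet_cell m k) 1
      (Or.inr (measure_ne_top _ _))).const_mul _
  have hest : (fun ω => densityEstimator m (fun j => X j ω) x)
      = fun ω => (1 / (n : ℝ)) * (∑ j, h ∘ X j) ω := by
    funext ω
    simp only [densityEstimator, Finset.sum_apply, Function.comp, hh]
    rw [Finset.sum_comm, Finset.mul_sum]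
    refine Finset.sum_congr rfl fun k _ => ?_
    rw [← Finset.mul_sum]
    ring
  have hvar : ∀ j, variance (h ∘ X j) P = variance h (densityMeasure f) := by
    intro j
    rw [← (hlaw j).map_eq, variance_map ?_ (hlaw j).aemeasurable]
    exact hmeas.aemeasurable
  rw [hest, variance_const_mul, IndepFun.variance_sum]
  · simp only [hvar, Finset.sum_const, Finset.card_univ, Fintype.card_fin, nsmul_eq_mul]
    rw [hh, variance_sum_mul_indicator_cell hm]
    have e1 : ∀ k, ((m : ℝ) ^ d * multinomialProb k (m - 1) x) ^ 2 *
        (densityMeasure f).real (cell m k) = (m : ℝ) ^ (2 * d) *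
          ((densityMeasure f).real (cell m k) * multinomialProb k (m - 1) x ^ 2) := fun k => by ring
    have e2 : ∀ k, ((m : ℝ) ^ d * multinomialProb k (m - 1) x) *
        (densityMeasure f).real (cell m k) = (m : ℝ) ^ d *
          ((densityMeasure f).real (cell m k) * multinomialProb k (m - 1) x) := fun k => by ring
    simp only [e1, e2, ← Finset.mul_sum]
    rw [mul_pow, ← pow_mul, mul_comm d 2]
    field_simp
  · intro j _
    have := (hlaw j).map_eq ▸ hL2
    exact (memLp_map_measure_iff (hmeas.aestronglyMeasurable) (hlaw j).aemeasurable).1 this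
  · intro i _ j _ hij
    exact (hX.indepFun hij).comp hmeas hmeas

end Variance

/-! ### Error bounds for the rescaled variance -/

section Error

variable {d : ℕ}

lemma sum_zeroOn (J : Finset (Fin d)) (x : Fin d → ℝ) :
    ∑ i, zeroOn J x i = ∑ i : ↥Jᶜ, x i := by
  rw [sum_eq_sum_subtype_compl_add J]
  have h1 : ∑ i ∈ J, zeroOn J x i = 0 := Finset.sum_eq_zero fun i hi => by simp [zeroOn, hi]
  rw [h1, add_zero]
  refine Finset.sum_congr rfl fun i _ => ?_
  have : (i : Fin d) ∉ J := Finset.mem_compl.1 i.2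
  simp [zeroOn, this]

/-- Coordinates in `J` are compared with `0`, and the mean of `k i / m` is at most `x i`, of order
`1/m` in the application. Only coordinates outside `J` contribute fluctuations of order `1/√m`. -/
lemma sum_multinomialProb_mul_sum_abs_sub_le (J : Finset (Fin d)) {m : ℕ} (hm : 1 ≤ m)
    {x : Fin d → ℝ} (hx : ∀ i, 0 ≤ x i) (hs : ∑ i, x i ≤ 1) :
    ∑ k ∈ indexSet d (m - 1),
        multinomialProb k (m - 1) x * (∑ i, |(k i : ℝ) / m - zeroOn J x i| + d / m)
      ≤ Jᶜ.card / √m + ∑ i ∈ J, x i + d / m := by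
  have hm0 : (0 : ℝ) < m := by exact_mod_cast hm
  have hcoord : ∀ i, ∑ k ∈ indexSet d (m - 1),
      multinomialProb k (m - 1) x * |(k i : ℝ) / m - zeroOn J x i|
        ≤ if i ∈ J then x i else 1 / √m := by
    intro i
    split_ifs with hi
    · have e : ∀ k : Fin d → ℕ, multinomialProb k (m - 1) x * |(k i : ℝ) / m - zeroOn J x i|
          = 1 / m * (multinomialProb k (m - 1) x * k i) := by
        intro k
        simp only [zeroOn, hi, if_true, sub_zero]
        rw [abs_of_nonneg (by positivity)]
        ring
      simp only [e, ← Finset.mul_sum, sum_multinomialProb_mul hx]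
      have h1 : ((m - 1 : ℕ) : ℝ) ≤ m := by exact_mod_cast Nat.sub_le m 1
      calc 1 / m * (((m - 1 : ℕ) : ℝ) * x i) ≤ 1 / m * (m * x i) := by gcongr; exact hx i
        _ = x i := by field_simp
    · simp only [zeroOn, hi, if_false]
      exact sum_multinomialProb_mul_abs_sub_le hm hx hs i
  have e : ∑ k ∈ indexSet d (m - 1),
      multinomialProb k (m - 1) x * (∑ i, |(k i : ℝ) / m - zeroOn J x i| + d / m)
      = ∑ i, ∑ k ∈ indexSet d (m - 1),
          multinomialProb k (m - 1) x * |(k i : ℝ) / m - zeroOn J x i| + d / m := by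
    simp only [mul_add, Finset.sum_add_distrib, ← Finset.sum_mul, sum_multinomialProb hx, one_mul,
      Finset.mul_sum]
    rw [Finset.sum_comm]
  rw [e]
  have h2 : ∑ i, (if i ∈ J then x i else 1 / √m) = Jᶜ.card / √m + ∑ i ∈ J, x i := by
    rw [← Finset.sum_compl_add_sum J, Finset.sum_congr rfl
      (g := fun _ => 1 / √(m : ℝ)) fun i hi => if_neg (Finset.mem_compl.1 hi),
      Finset.sum_congr rfl (g := x) fun i hi => if_pos hi, Finset.sum_const, nsmul_eq_mul]
    ring
  rw [← h2]
  gcongr with i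
  exact hcoord i

/-- This is the size of the squared-mean term. For `a = 0` the exponent is `-d ≤ -1`; for `1 ≤ a ≤
d` it is `a / 2 - d ≤ -1/2`. When `J` is everything, no `1/√m` remains. -/
lemma rpow_half_mul_inv_pow_le (hd : 1 ≤ d) {a m : ℕ} (had : a ≤ d) (hm : 1 ≤ m) :
    (m : ℝ) ^ ((a : ℝ) / 2) * ((m : ℝ) ^ d)⁻¹ ≤ 1 / m + a / √m := by
  have hm1 : (1 : ℝ) ≤ m := by exact_mod_cast hm
  have hm0 : (0 : ℝ) < m := by linarith
  have hd1 : (1 : ℝ) ≤ d := by exact_mod_cast hd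
  have had1 : (a : ℝ) ≤ d := by exact_mod_cast had
  rw [← Real.rpow_natCast, ← Real.rpow_neg hm0.le, ← Real.rpow_add hm0]
  rcases Nat.eq_zero_or_pos a with h | h
  · subst h
    have : (m : ℝ) ^ (((0 : ℕ) : ℝ) / 2 + -(d : ℝ)) ≤ (m : ℝ) ^ (-1 : ℝ) :=
      Real.rpow_le_rpow_of_exponent_le hm1 (by push_cast; linarith)
    rw [Real.rpow_neg_one] at this
    simpa using this
  · have ha1 : (1 : ℝ) ≤ a := by exact_mod_cast h
    have h1 : (m : ℝ) ^ ((a : ℝ) / 2 + -(d : ℝ)) ≤ (m : ℝ) ^ (-(1 / 2) : ℝ) :=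
      Real.rpow_le_rpow_of_exponent_le hm1 (by linarith)
    rw [Real.rpow_neg hm0.le, ← Real.sqrt_eq_rpow, ← one_div] at h1
    have h2 : 1 / √(m : ℝ) ≤ a / √m := by gcongr
    have h3 : 0 ≤ 1 / (m : ℝ) := by positivity
    linarith

/-- `n` times the variance of the estimator, rescaled by `m ^ (-(d + |J|) / 2)`. -/
noncomputable def scaledVariance (f : (Fin d → ℝ) → ℝ) (J : Finset (Fin d)) (m : ℕ)
    (x : Fin d → ℝ) : ℝ :=
  (m : ℝ) ^ ((Jᶜ.card : ℝ) / 2) * (∑ k ∈ indexSet d (m - 1),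
      ((m : ℝ) ^ d * (densityMeasure f).real (cell m k)) * multinomialProb k (m - 1) x ^ 2
    - ((m : ℝ) ^ d)⁻¹ * (∑ k ∈ indexSet d (m - 1),
      ((m : ℝ) ^ d * (densityMeasure f).real (cell m k)) * multinomialProb k (m - 1) x) ^ 2)

lemma rpow_mul_scaledVariance {f : (Fin d → ℝ) → ℝ} (J : Finset (Fin d)) {m : ℕ} (hm : 1 ≤ m)
    (x : Fin d → ℝ) :
    (m : ℝ) ^ (((d : ℝ) + J.card) / 2) * scaledVariance f J m x
      = (m : ℝ) ^ (2 * d) * (∑ k ∈ indexSet d (m - 1),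
            (densityMeasure f).real (cell m k) * multinomialProb k (m - 1) x ^ 2
          - (∑ k ∈ indexSet d (m - 1),
            (densityMeasure f).real (cell m k) * multinomialProb k (m - 1) x) ^ 2) := by
  have hm0 : (0 : ℝ) < m := by exact_mod_cast hm
  have hcard : (Jᶜ.card : ℝ) = d - J.card := by
    rw [Finset.card_compl, Fintype.card_fin, Nat.cast_sub]
    simpa using Finset.card_le_univ J
  have h1 : (m : ℝ) ^ (((d : ℝ) + J.card) / 2) * (m : ℝ) ^ ((Jᶜ.card : ℝ) / 2) = (m : ℝ) ^ d := by
    rw [← Real.rpow_add hm0, ← Real.rpow_natCast, hcard]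
    congr 1; ring
  rw [scaledVariance, ← mul_assoc, h1]
  simp only [mul_assoc, ← Finset.mul_sum]
  have hd0 : (m : ℝ) ^ d ≠ 0 := by positivity
  rw [mul_comm 2 d, pow_mul]
  field_simp

/-- The Gaussian factor for the coordinates outside `J`. -/
noncomputable def gaussianFactor {ι : Type*} [Fintype ι] (y : ι → ℝ) : ℝ :=
  ((4 * Real.pi) ^ Fintype.card ι * (1 - ∑ i, y i) * ∏ i, y i) ^ (-(1 / 2) : ℝ)

/-- The rescaled collision probability of the coordinates outside `J`, in Fourier form. -/
noncomputable def scaledCollision {ι : Type*} [Fintype ι] (y : ι → ℝ) (m : ℕ) : ℝ :=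
  (m : ℝ) ^ ((Fintype.card ι : ℝ) / 2) *
    ∫ t, (‖stepChar y t‖ ^ 2) ^ (m - 1) ∂torusMeasure ι

lemma psi_eq_gaussianFactor (A : Finset (Fin d)) (x : Fin d → ℝ) :
    psi A x = gaussianFactor fun i : ↥A => x i := by
  rw [psi, gaussianFactor, Fintype.card_coe, Finset.sum_coe_sort A x, Finset.prod_coe_sort A x]

variable {f : (Fin d → ℝ) → ℝ}

lemma sum_cell_mul_multinomialProb_mem (hf : IsSimplexDensity f) {B : ℝ}
    (hB : ∀ v, f v ≤ B) {m : ℕ} (hm : 1 ≤ m) {x : Fin d → ℝ} (hx : ∀ i, 0 ≤ x i)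
    (hs : ∑ i, x i ≤ 1) :
    (∑ k ∈ indexSet d (m - 1),
      ((m : ℝ) ^ d * (densityMeasure f).real (cell m k)) * multinomialProb k (m - 1) x)
        ∈ Set.Icc 0 B ∧
    (∑ k ∈ indexSet d (m - 1),
      ((m : ℝ) ^ d * (densityMeasure f).real (cell m k)) * multinomialProb k (m - 1) x ^ 2)
        ∈ Set.Icc 0 B := by
  have hB0 : 0 ≤ B := (hf.nonneg 0).trans (hB 0)
  have hg0 : ∀ k : Fin d → ℕ, 0 ≤ (m : ℝ) ^ d * (densityMeasure f).real (cell m k) :=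
    fun k => by positivity
  have hP : ∀ k ∈ indexSet d (m - 1), 0 ≤ multinomialProb k (m - 1) x := fun k hk =>
    multinomialProb_nonneg hx hs hk
  have h1 : ∑ k ∈ indexSet d (m - 1),
      ((m : ℝ) ^ d * (densityMeasure f).real (cell m k)) * multinomialProb k (m - 1) x ≤ B := by
    calc _ ≤ ∑ k ∈ indexSet d (m - 1), B * multinomialProb k (m - 1) x :=
          Finset.sum_le_sum fun k hk => mul_le_mul_of_nonneg_right
            (hf.pow_mul_measureReal_cell_le hB hm k) (hP k hk)
      _ = B := by rw [← Finset.mul_sum, sum_multinomialProb hx, mul_one]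
  refine ⟨⟨Finset.sum_nonneg fun k hk => mul_nonneg (hg0 k) (hP k hk), h1⟩,
    Finset.sum_nonneg fun k hk => mul_nonneg (hg0 k) (sq_nonneg _), le_trans ?_ h1⟩
  refine Finset.sum_le_sum fun k hk => mul_le_mul_of_nonneg_left ?_ (hg0 k)
  rw [sq]
  exact mul_le_of_le_one_left (hP k hk) (multinomialProb_le_one hx hs hk)

lemma prod_exp_mul_besselI_mem (J : Finset (Fin d)) {l : ↥J → ℝ} (hl : ∀ i, 0 ≤ l i) :
    ∏ i, (Real.exp (-2 * l i) * besselI 0 (2 * l i)) ∈ Set.Icc (0 : ℝ) 1 :=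
  ⟨Finset.prod_nonneg fun _ _ => exp_mul_besselI_nonneg _,
    Finset.prod_le_one (fun _ _ => exp_mul_besselI_nonneg _)
      fun i _ => exp_mul_besselI_le_one (hl i)⟩

lemma variance_error_le {K₃ K₂ B e τ a m r δ : ℝ} (hK₃ : 0 ≤ K₃) (hK₂ : 0 ≤ K₂) (hB : 0 ≤ B)
    (he : 0 ≤ e) (hτ : 0 ≤ τ) (ha : 0 ≤ a) (hm : 0 < m) (hr : 0 < r) (hδ : 0 ≤ δ) :
    K₃ * (a / r + τ / m + e / m) + B * (K₂ * (τ * a / r + (τ ^ 2 + τ) / m)) + B * δ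
        + B ^ 2 * (1 / m + a / r)
      ≤ (K₃ * (1 + e) + B * K₂ + B ^ 2 + B) * ((1 + τ) ^ 2 / m + (1 + τ) * a / r)
        + (K₃ * (1 + e) + B * K₂ + B ^ 2 + B) * δ := by
  obtain ⟨u, hu⟩ : ∃ u, u = (1 + τ) ^ 2 / m := ⟨_, rfl⟩
  obtain ⟨v, hv⟩ : ∃ v, v = (1 + τ) * a / r := ⟨_, rfl⟩
  have hu0 : 0 ≤ u := by rw [hu]; positivity
  have hv0 : 0 ≤ v := by rw [hv]; positivity
  have b1 : a / r ≤ v := by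
    rw [hv]
    exact div_le_div_of_nonneg_right (by nlinarith) hr.le
  have b2 : τ / m ≤ u := by
    rw [hu]
    exact div_le_div_of_nonneg_right (by nlinarith) hm.le
  have b3 : 1 / m ≤ u := by
    rw [hu]
    exact div_le_div_of_nonneg_right (by nlinarith) hm.le
  have b4 : τ * a / r ≤ v := by
    rw [hv]
    exact div_le_div_of_nonneg_right (by nlinarith) hr.le
  have b5 : (τ ^ 2 + τ) / m ≤ u := by
    rw [hu]
    exact div_le_div_of_nonneg_right (by nlinarith) hm.le
  have b6 : e / m ≤ e * u := by
    rw [div_eq_mul_one_div]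
    exact mul_le_mul_of_nonneg_left b3 he
  rw [← hu, ← hv]
  calc _ ≤ K₃ * (v + u + e * u) + B * (K₂ * (v + u)) + B * δ + B ^ 2 * (u + v) := by gcongr
    _ ≤ _ := by
        have c1 : 0 ≤ K₃ * e * v := by positivity
        have c2 : 0 ≤ B * (u + v) := by positivity
        have c3 : 0 ≤ (K₃ * (1 + e) + B * K₂ + B ^ 2) * δ := by positivity
        linarith

/-- The error bound in the regime where the coordinates from `J` stay away from the face
`∑ x i = 1`. -/
lemma exists_abs_scaledVariance_sub_le_of_small (hd : 1 ≤ d) (hf : IsSimplexDensity f)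
    (hf2 : IsC2OnSimplex f) (J : Finset (Fin d)) {y : ↥Jᶜ → ℝ} (hy : ∀ i, 0 < y i)
    (hs : ∑ i, y i < 1) :
    ∃ K : ℝ, 0 ≤ K ∧ ∀ m : ℕ, 1 ≤ m → ∀ x ∈ simplex d, (∀ i : ↥Jᶜ, x i = y i) →
      ∑ i ∈ J, x i ≤ (1 - ∑ i, y i) / 2 →
      |scaledVariance f J m x - f (zeroOn J x) * gaussianFactor y *
          ∏ i : ↥J, (Real.exp (-2 * (m * x i)) * besselI 0 (2 * (m * x i)))|
        ≤ K * ((1 + m * ∑ i ∈ J, x i) ^ 2 / m + (1 + m * ∑ i ∈ J, x i) * Jᶜ.card / √m)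
          + K * |scaledCollision y m - gaussianFactor y| := by
  obtain ⟨L, hL0, hL⟩ := hf2.exists_lipschitz
  obtain ⟨B, hB0, hB⟩ := hf.exists_le hf2
  obtain ⟨K₁, hK₁0, hK₁⟩ := exists_rpow_mul_multinomialProb_le J hy hs
  obtain ⟨K₂, hK₂0, hK₂⟩ := exists_abs_rpow_mul_sum_sq_sub_le J hy hs
  set c := 1 - ∑ i, y i with hc
  have hc0 : 0 < c := by linarith
  set K₃ := K₁ * (L + B / c) with hK₃
  have hK₃0 : 0 ≤ K₃ := by positivity
  refine ⟨K₃ * (1 + d) + B * K₂ + B ^ 2 + B, by positivity, fun m hm x hxs hxy hxJ => ?_⟩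
  obtain ⟨hx, hsum⟩ := mem_simplex_iff.1 hxs
  have hm0 : (0 : ℝ) < m := by exact_mod_cast hm
  have hr : 0 < √(m : ℝ) := Real.sqrt_pos.2 hm0
  set s := ∑ i ∈ J, x i with hs_def
  have hs0 : 0 ≤ s := Finset.sum_nonneg fun i _ => hx i
  set q := (m : ℝ) ^ ((Jᶜ.card : ℝ) / 2) with hq
  have hq0 : 0 ≤ q := by positivity
  set a : ℝ := (Jᶜ.card : ℝ) with ha
  have ha0 : 0 ≤ a := by positivity
  set Pr := ∏ i : ↥J, (Real.exp (-2 * (m * x i)) * besselI 0 (2 * (m * x i))) with hPr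
  have hPr01 : Pr ∈ Set.Icc (0 : ℝ) 1 :=
    prod_exp_mul_besselI_mem J fun i => mul_nonneg hm0.le (hx i)
  set x₀ := zeroOn J x with hx₀
  have hx₀s : x₀ ∈ simplex d := zeroOn_mem_simplex J hxs
  have hx₀c : ∑ i, x₀ i ≤ 1 - c := by
    rw [hx₀, sum_zeroOn]
    simp only [hxy]
    linarith
  have hfx : |f x₀| ≤ B := by rw [abs_of_nonneg (hf.nonneg _)]; exact hB _
  set g : (Fin d → ℕ) → ℝ := fun k => (m : ℝ) ^ d * (densityMeasure f).real (cell m k) with hg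
  set S₂ := ∑ k ∈ indexSet d (m - 1), multinomialProb k (m - 1) x ^ 2 with hS₂
  have hT₁ : |q * ∑ k ∈ indexSet d (m - 1), g k * multinomialProb k (m - 1) x ^ 2
      - f x₀ * (q * S₂)| ≤ K₃ * (a / √m + s + d / m) := by
    have e : q * ∑ k ∈ indexSet d (m - 1), g k * multinomialProb k (m - 1) x ^ 2
        - f x₀ * (q * S₂) = ∑ k ∈ indexSet d (m - 1),
          (g k - f x₀) * (q * multinomialProb k (m - 1) x) * multinomialProb k (m - 1) x := by
      rw [hS₂, Finset.mul_sum, Finset.mul_sum, Finset.mul_sum, ← Finset.sum_sub_distrib]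
      exact Finset.sum_congr rfl fun k _ => by ring
    rw [e]
    refine (Finset.abs_sum_le_sum_abs _ _).trans ?_
    calc _ ≤ ∑ k ∈ indexSet d (m - 1), K₃ * (multinomialProb k (m - 1) x *
          (∑ i, |(k i : ℝ) / m - x₀ i| + d / m)) := by
          refine Finset.sum_le_sum fun k hk => ?_
          have hP0 := multinomialProb_nonneg hx hsum hk
          have h1 := hf.abs_pow_mul_measureReal_cell_sub_le hL0 hB0 hc0 hL hB hx₀s hx₀c hm k
          have h2 := hK₁ m hm x hx hxy hxJ k hk
          rw [abs_mul, abs_mul, abs_of_nonneg hP0, abs_of_nonneg (mul_nonneg hq0 hP0)]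
          calc _ ≤ ((L + B / c) * (∑ i, |(k i : ℝ) / m - x₀ i| + d / m)) * K₁
                * multinomialProb k (m - 1) x := by gcongr
            _ = _ := by rw [hK₃]; ring
      _ ≤ _ := by
          rw [← Finset.mul_sum]
          gcongr
          exact sum_multinomialProb_mul_sum_abs_sub_le J hm hx hsum
  have hT₂ : |f x₀ * (q * S₂) - f x₀ * (scaledCollision y m * Pr)|
      ≤ B * (K₂ * ((m * s) * a / √m + ((m * s) ^ 2 + m * s) / m)) := by
    rw [← mul_sub, abs_mul, scaledCollision, Fintype.card_coe]
    exact mul_le_mul hfx (hK₂ m hm x hx hxy hxJ) (abs_nonneg _) hB0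
  have hT₃ : |f x₀ * (scaledCollision y m * Pr) - f x₀ * gaussianFactor y * Pr|
      ≤ B * |scaledCollision y m - gaussianFactor y| := by
    rw [show f x₀ * (scaledCollision y m * Pr) - f x₀ * gaussianFactor y * Pr
      = f x₀ * (scaledCollision y m - gaussianFactor y) * Pr by ring, abs_mul, abs_mul,
      abs_of_nonneg hPr01.1]
    calc _ ≤ B * |scaledCollision y m - gaussianFactor y| * 1 :=
          mul_le_mul (mul_le_mul_of_nonneg_right hfx (abs_nonneg _)) hPr01.2 hPr01.1
            (mul_nonneg hB0 (abs_nonneg _))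
      _ = _ := mul_one _
  have hT₄ : |q * (((m : ℝ) ^ d)⁻¹ *
      (∑ k ∈ indexSet d (m - 1), g k * multinomialProb k (m - 1) x) ^ 2)|
        ≤ B ^ 2 * (1 / m + a / √m) := by
    obtain ⟨⟨h1, h2⟩, -⟩ := sum_cell_mul_multinomialProb_mem hf hB hm hx hsum
    have h3 := rpow_half_mul_inv_pow_le hd (a := Jᶜ.card)
      (by simpa using Finset.card_le_univ Jᶜ) hm
    rw [abs_of_nonneg (by positivity), ← mul_assoc, mul_comm]
    gcongr
  -- Four errors: freezing the density at `x₀`, factorizing the collision probability, the Gaussian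
  -- limit, and the squared mean.
  have hfin : scaledVariance f J m x - f x₀ * gaussianFactor y * Pr
      = (q * ∑ k ∈ indexSet d (m - 1), g k * multinomialProb k (m - 1) x ^ 2 - f x₀ * (q * S₂))
        + (f x₀ * (q * S₂) - f x₀ * (scaledCollision y m * Pr))
        + (f x₀ * (scaledCollision y m * Pr) - f x₀ * gaussianFactor y * Pr)
        - q * (((m : ℝ) ^ d)⁻¹ *
      (∑ k ∈ indexSet d (m - 1), g k * multinomialProb k (m - 1) x) ^ 2) := by
    rw [scaledVariance]; ring
  rw [hfin]
  refine (abs_sub _ _).trans ((add_le_add ((abs_add_le _ _).trans (add_le_add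
    ((abs_add_le _ _).trans (add_le_add hT₁ hT₂)) hT₃)) hT₄).trans ?_)
  have hsτ : s = m * s / m := by field_simp
  rw [show K₃ * (a / √m + s + d / m) = K₃ * (a / √m + m * s / m + d / m) by rw [← hsτ]]
  exact variance_error_le hK₃0 hK₂0 hB0 (Nat.cast_nonneg d) (by positivity) ha0 hm0 hr
    (abs_nonneg _)

/-- A crude error bound in the complementary regime. -/
lemma exists_abs_scaledVariance_sub_le_of_large (hf : IsSimplexDensity f)
    (hf2 : IsC2OnSimplex f) (J : Finset (Fin d)) {y : ↥Jᶜ → ℝ} (hy : ∀ i, 0 < y i)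
    (hs : ∑ i, y i < 1) :
    ∃ K : ℝ, 0 ≤ K ∧ ∀ m : ℕ, 1 ≤ m → ∀ x ∈ simplex d,
      (1 - ∑ i, y i) / 2 < ∑ i ∈ J, x i →
      |scaledVariance f J m x - f (zeroOn J x) * gaussianFactor y *
          ∏ i : ↥J, (Real.exp (-2 * (m * x i)) * besselI 0 (2 * (m * x i)))|
        ≤ K * ((1 + m * ∑ i ∈ J, x i) ^ (d + 1) / m) := by
  obtain ⟨B, hB0, hB⟩ := hf.exists_le hf2
  set c := 1 - ∑ i, y i with hc
  have hc0 : 0 < c := by linarith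
  have hψ0 : 0 ≤ gaussianFactor y := by
    have h1 : 0 ≤ ∏ i, y i := Finset.prod_nonneg fun i _ => (hy i).le
    have hp := Real.pi_pos
    rw [gaussianFactor, ← hc]
    positivity
  -- Here `∑_J x > c / 2`, so `m ≤ (2 / c) (1 + m ∑_J x)`, and the trivial size `m ^ d = m ^ (d + 1)
  -- / m` is admissible.
  refine ⟨(B + B ^ 2 + B * gaussianFactor y) * (2 / c) ^ (d + 1), by positivity,
    fun m hm x hxs hxJ => ?_⟩
  obtain ⟨hx, hsum⟩ := mem_simplex_iff.1 hxs
  have hm1 : (1 : ℝ) ≤ m := by exact_mod_cast hm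
  have hm0 : (0 : ℝ) < m := by linarith
  set s := ∑ i ∈ J, x i with hs_def
  have hs0 : 0 ≤ s := Finset.sum_nonneg fun i _ => hx i
  set q := (m : ℝ) ^ ((Jᶜ.card : ℝ) / 2) with hq
  have hq0 : 0 ≤ q := by positivity
  have hmd1 : 1 ≤ (m : ℝ) ^ d := one_le_pow₀ hm1
  have hqd : q ≤ (m : ℝ) ^ d := by
    rw [hq, ← Real.rpow_natCast]
    have : (Jᶜ.card : ℝ) ≤ d := by exact_mod_cast (by simpa using Finset.card_le_univ Jᶜ)
    have : (0 : ℝ) ≤ Jᶜ.card := Nat.cast_nonneg _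
    exact Real.rpow_le_rpow_of_exponent_le hm1 (by linarith)
  set Pr := ∏ i : ↥J, (Real.exp (-2 * (m * x i)) * besselI 0 (2 * (m * x i))) with hPr
  have hPr01 : Pr ∈ Set.Icc (0 : ℝ) 1 :=
    prod_exp_mul_besselI_mem J fun i => mul_nonneg hm0.le (hx i)
  obtain ⟨⟨h1, h2⟩, h3, h4⟩ := sum_cell_mul_multinomialProb_mem hf hB hm hx hsum
  have hinv : ((m : ℝ) ^ d)⁻¹ ≤ 1 := inv_le_one_of_one_le₀ hmd1
  have hinv0 : 0 ≤ ((m : ℝ) ^ d)⁻¹ := by positivity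
  have hV : |scaledVariance f J m x| ≤ (m : ℝ) ^ d * (B + B ^ 2) := by
    rw [scaledVariance, abs_mul, abs_of_nonneg hq0]
    refine mul_le_mul hqd ((abs_sub _ _).trans (add_le_add ?_ ?_)) (abs_nonneg _) (by positivity)
    · rwa [abs_of_nonneg h3]
    · rw [abs_of_nonneg (mul_nonneg hinv0 (sq_nonneg _))]
      calc _ ≤ 1 * B ^ 2 := by gcongr
        _ = B ^ 2 := one_mul _
  have hT : |f (zeroOn J x) * gaussianFactor y * Pr| ≤ (m : ℝ) ^ d * (B * gaussianFactor y) := by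
    rw [abs_of_nonneg (mul_nonneg (mul_nonneg (hf.nonneg _) hψ0) hPr01.1)]
    calc _ ≤ B * gaussianFactor y * 1 :=
          mul_le_mul (mul_le_mul_of_nonneg_right (hB _) hψ0) hPr01.2 hPr01.1
            (mul_nonneg hB0 hψ0)
      _ ≤ (m : ℝ) ^ d * (B * gaussianFactor y) := by
          rw [mul_one]
          exact le_mul_of_one_le_left (mul_nonneg hB0 hψ0) hmd1
  have hmd : (m : ℝ) ^ d ≤ (2 / c) ^ (d + 1) * ((1 + m * s) ^ (d + 1) / m) := by
    rw [← mul_div_assoc, le_div_iff₀ hm0, ← pow_succ, ← mul_pow]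
    refine pow_le_pow_left₀ hm0.le ?_ _
    rw [div_mul_eq_mul_div, le_div_iff₀ hc0]
    nlinarith
  refine (abs_sub _ _).trans ((add_le_add hV hT).trans ?_)
  rw [← mul_add, mul_comm, mul_assoc]
  gcongr

/-- The error bound in all regimes. -/
theorem exists_abs_scaledVariance_sub_le (hd : 1 ≤ d) (hf : IsSimplexDensity f)
    (hf2 : IsC2OnSimplex f) (J : Finset (Fin d)) {y : ↥Jᶜ → ℝ} (hy : ∀ i, 0 < y i)
    (hs : ∑ i, y i < 1) :
    ∃ K : ℝ, 0 ≤ K ∧ ∀ m : ℕ, 1 ≤ m → ∀ x ∈ simplex d, (∀ i : ↥Jᶜ, x i = y i) →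
      |scaledVariance f J m x - f (zeroOn J x) * gaussianFactor y *
          ∏ i : ↥J, (Real.exp (-2 * (m * x i)) * besselI 0 (2 * (m * x i)))|
        ≤ K * ((1 + m * ∑ i ∈ J, x i) ^ (d + 2) / m + (1 + m * ∑ i ∈ J, x i) * Jᶜ.card / √m)
          + K * |scaledCollision y m - gaussianFactor y| := by
  obtain ⟨K₁, hK₁0, hK₁⟩ := exists_abs_scaledVariance_sub_le_of_small hd hf hf2 J hy hs
  obtain ⟨K₂, hK₂0, hK₂⟩ := exists_abs_scaledVariance_sub_le_of_large hf hf2 J hy hs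
  refine ⟨K₁ + K₂, by positivity, fun m hm x hxs hxy => ?_⟩
  have hx := (mem_simplex_iff.1 hxs).1
  have hm0 : (0 : ℝ) < m := by exact_mod_cast hm
  have hs0 : 0 ≤ ∑ i ∈ J, x i := Finset.sum_nonneg fun i _ => hx i
  set T := 1 + m * ∑ i ∈ J, x i with hT
  have hT1 : 1 ≤ T := by
    have : 0 ≤ m * ∑ i ∈ J, x i := by positivity
    linarith
  have hT0 : 0 ≤ T := by linarith
  have hv0 : 0 ≤ T * Jᶜ.card / √m := by positivity
  have hδ0 := abs_nonneg (scaledCollision y m - gaussianFactor y)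
  rcases le_or_gt (∑ i ∈ J, x i) ((1 - ∑ i, y i) / 2) with h | h
  · refine (hK₁ m hm x hxs hxy h).trans ?_
    have h1 : T ^ 2 / m ≤ T ^ (d + 2) / m := by
      gcongr
      omega
    have h2 : 0 ≤ T ^ (d + 2) / m := by positivity
    gcongr
    · linarith
    · linarith
  · refine (hK₂ m hm x hxs h).trans ?_
    have h1 : T ^ (d + 1) / m ≤ T ^ (d + 2) / m := by
      gcongr
      omega
    have h2 : 0 ≤ T ^ (d + 2) / m := by positivity
    calc K₂ * (T ^ (d + 1) / m) ≤ (K₁ + K₂) * (T ^ (d + 2) / m + T * Jᶜ.card / √m) := by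
          gcongr
          · linarith
          · linarith
      _ ≤ _ := le_add_of_nonneg_right (mul_nonneg (add_nonneg hK₁0 hK₂0) hδ0)

end Error

/-! ### Separation of constants and conclusion -/

lemma exists_eq_add_of_abs_le_add {E α β : ℝ} (hα : 0 ≤ α) (hβ : 0 ≤ β) (h : |E| ≤ α + β) :
    ∃ e₁ e₂ : ℝ, |e₁| ≤ α ∧ |e₂| ≤ β ∧ E = e₁ + e₂ := by
  obtain ⟨h1, h2⟩ := abs_le.1 h
  rcases le_total E (-α) with h3 | h3
  · exact ⟨-α, E + α, by rw [abs_neg, abs_of_nonneg hα], abs_le.2 ⟨by linarith, by linarith⟩,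
      by ring⟩
  rcases le_total E α with h4 | h4
  · exact ⟨E, 0, abs_le.2 ⟨h3, h4⟩, by rwa [abs_zero], by ring⟩
  · exact ⟨α, E - α, by rw [abs_of_nonneg hα], abs_le.2 ⟨by linarith, by linarith⟩, by ring⟩

/-- Separation of the constants depending on `x` outside `J` from those depending on `λ`. -/
lemma mul_add_div_sqrt_le {K a T : ℝ} {p m : ℕ} (hK : 0 ≤ K) (ha : 0 ≤ a) (hT : 1 ≤ T)
    (hm : 1 ≤ m) :
    K * (T ^ p / m + T * a / √m)
      ≤ (T ^ (2 * p) + T ^ 8) * (m : ℝ)⁻¹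
        + ((K ^ 2 + (K * a) ^ 2) * (m : ℝ)⁻¹ + K * a * (√√(m : ℝ))⁻¹) := by
  have hm0 : (0 : ℝ) < m := by exact_mod_cast hm
  set r := √(m : ℝ) with hr_def
  have hr : 0 < r := Real.sqrt_pos.2 hm0
  have hrm : r ^ 2 = m := Real.sq_sqrt hm0.le
  set u := √r with hu_def
  have hu : 0 < u := Real.sqrt_pos.2 hr
  have hur : u ^ 2 = r := Real.sq_sqrt hr.le
  have h1 : K * (T ^ p / m) ≤ (T ^ (2 * p) + K ^ 2) * (m : ℝ)⁻¹ := by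
    rw [← mul_div_assoc, div_eq_mul_inv]
    gcongr
    rw [mul_comm 2 p, pow_mul]
    nlinarith [sq_nonneg (T ^ p - K), sq_nonneg (T ^ p), sq_nonneg K]
  obtain ⟨κ, hκ⟩ : ∃ κ, κ = K * a := ⟨_, rfl⟩
  have hκ0 : 0 ≤ κ := by rw [hκ]; positivity
  -- Here `u = m^(1/4)`. If `T ≤ u`, the first term suffices and is worth `κ m^(-1/4)` after
  -- division by `m`. If `u ≤ T`, the left side is at most `κ T⁴`, and AM-GM separates `κ` from `T`.
  have h2 : κ * T * u ^ 2 ≤ κ * u ^ 3 + κ ^ 2 + T ^ 8 := by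
    rcases le_total T u with h | h
    · have := mul_le_mul_of_nonneg_left h (mul_nonneg hκ0 (sq_nonneg u))
      have h8 : 0 ≤ T ^ 8 := by positivity
      nlinarith [sq_nonneg κ]
    · have h3 : κ * T * u ^ 2 ≤ κ * T * T ^ 2 := by gcongr
      have h4 : T ^ 3 ≤ T ^ 4 := pow_le_pow_right₀ hT (by norm_num)
      have h5 : κ * T ^ 3 ≤ κ * T ^ 4 := by gcongr
      have h6 : 0 ≤ κ * u ^ 3 := by positivity
      nlinarith [sq_nonneg (κ - T ^ 4), sq_nonneg (T ^ 4), sq_nonneg κ]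
  have h7 : K * (T * a / r) ≤ κ * u⁻¹ + (κ ^ 2 + T ^ 8) * (m : ℝ)⁻¹ := by
    have e1 : K * (T * a / r) = κ * T * u ^ 2 * (m : ℝ)⁻¹ := by
      rw [← hrm, ← hur, hκ]; field_simp
    have e2 : κ * u⁻¹ = κ * u ^ 3 * (m : ℝ)⁻¹ := by
      rw [← hrm, ← hur]; field_simp
    rw [e1, e2, ← add_mul]
    gcongr
    linarith
  rw [mul_add]
  rw [hκ] at h7
  linarith

end BernsteinSimplex

open BernsteinSimplex in
theorem theorem2 (d : ℕ) (hd : 1 ≤ d) (f : (Fin d → ℝ) → ℝ)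
    (hf : BernsteinSimplex.IsSimplexDensity f) (hf2 : BernsteinSimplex.IsC2OnSimplex f)
    (J : Finset (Fin d)) :
    ∃ (C : (↥J → ℝ) → ℝ) (r : (↥(Jᶜ) → ℝ) → ℕ → ℝ),
      (∀ y, Filter.Tendsto (r y) Filter.atTop (nhds 0)) ∧
      ∀ (lam : ↥J → ℝ) (m n : ℕ) (x : Fin d → ℝ), (∀ i, 0 ≤ lam i) → 1 ≤ m → 1 ≤ n →
        x ∈ BernsteinSimplex.simplex d →
        (∀ i : ↥J, x i = lam i / m) →
        (∀ i ∈ Jᶜ, x i ∈ Set.Ioo (0 : ℝ) 1) →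
        ∑ i ∈ Jᶜ, x i < 1 →
        ∀ (Ω : Type*) [MeasurableSpace Ω] (P : MeasureTheory.Measure Ω)
          [MeasureTheory.IsProbabilityMeasure P] (X : Fin n → Ω → Fin d → ℝ),
          ProbabilityTheory.iIndepFun X P →
          (∀ j, ProbabilityTheory.HasLaw (X j)
            (MeasureTheory.volume.withDensity fun y => ENNReal.ofReal (f y)) P) →
          ∃ e₁ e₂ : ℝ, |e₁| ≤ C lam * (m : ℝ)⁻¹ ∧ |e₂| ≤ r (fun i => x i) m ∧
            ProbabilityTheory.variance
                (fun ω => BernsteinSimplex.densityEstimator m (fun j => X j ω) x) P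
              = (n : ℝ)⁻¹ * (m : ℝ) ^ (((d : ℝ) + (J.card : ℝ)) / 2) *
                (f (BernsteinSimplex.zeroOn J x) * BernsteinSimplex.psi Jᶜ x
                    * ∏ i : ↥J, (Real.exp (-2 * lam i) * BernsteinSimplex.besselI 0 (2 * lam i))
                  + e₁ + if J ≠ Finset.univ then e₂ else 0) := by
  classical
  have key : ∀ y : ↥Jᶜ → ℝ, ∃ K : ℝ, 0 ≤ K ∧ (((∀ i, 0 < y i) ∧ ∑ i, y i < 1) →
      ∀ m : ℕ, 1 ≤ m → ∀ x ∈ simplex d, (∀ i : ↥Jᶜ, x i = y i) →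
      |scaledVariance f J m x - f (zeroOn J x) * gaussianFactor y *
          ∏ i : ↥J, (Real.exp (-2 * (m * x i)) * besselI 0 (2 * (m * x i)))|
        ≤ K * ((1 + m * ∑ i ∈ J, x i) ^ (d + 2) / m + (1 + m * ∑ i ∈ J, x i) * Jᶜ.card / √m)
          + K * |scaledCollision y m - gaussianFactor y|) := by
    intro y
    by_cases hy : (∀ i, 0 < y i) ∧ ∑ i, y i < 1
    · obtain ⟨K, hK0, hK⟩ := exists_abs_scaledVariance_sub_le hd hf hf2 J hy.1 hy.2
      exact ⟨K, hK0, fun _ => hK⟩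
    · exact ⟨0, le_rfl, fun h => absurd h hy⟩
  choose K hK0 hK using key
  have main : ∃ (C : (↥J → ℝ) → ℝ) (r : (↥Jᶜ → ℝ) → ℕ → ℝ), (∀ l, (∀ i, 0 ≤ l i) → 0 ≤ C l) ∧
      (∀ y m, 0 ≤ r y m) ∧ (∀ y, Filter.Tendsto (r y) Filter.atTop (nhds 0)) ∧
      (J = Finset.univ → ∀ y m, r y m = 0) ∧
      ∀ (l : ↥J → ℝ) (y : ↥Jᶜ → ℝ) (m : ℕ), (∀ i, 0 ≤ l i) → 1 ≤ m →
        ((∀ i, 0 < y i) ∧ ∑ i, y i < 1) →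
        K y * ((1 + ∑ i, l i) ^ (d + 2) / m + (1 + ∑ i, l i) * Jᶜ.card / √m)
          + K y * |scaledCollision y m - gaussianFactor y| ≤ C l * (m : ℝ)⁻¹ + r y m := by
    by_cases hJ : J = Finset.univ
    -- There is only one `y`, so its constant may enter `C`. The collision integral and the Gaussian
    -- factor both equal `1`, so the whole error is `O(m⁻¹)`.
    · have hempty : IsEmpty ↥Jᶜ := Finset.isEmpty_coe_sort.2 (by rw [hJ, Finset.compl_univ])
      refine ⟨fun l => K 0 * (1 + ∑ i, l i) ^ (d + 2), fun _ _ => 0, fun l hl => ?_,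
        fun _ _ => le_rfl, fun _ => tendsto_const_nhds, fun _ _ _ => rfl,
        fun l y m _ _ _ => ?_⟩
      · have : 0 ≤ ∑ i, l i := Finset.sum_nonneg fun i _ => hl i
        have := hK0 0
        positivity
      · have h1 : y = 0 := Subsingleton.elim _ _
        have h2 : Jᶜ.card = 0 := by subst hJ; simp
        have h3 : scaledCollision y m = gaussianFactor y := by
          rw [scaledCollision, gaussianFactor, Fintype.card_eq_zero]
          simp [stepChar]
        rw [h1, h2, ← h1, h3]
        simp only [Nat.cast_zero, mul_zero, zero_div, add_zero, sub_self, abs_zero]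
        rw [← mul_div_assoc, div_eq_mul_inv]
    -- `C` is free of `y` and `r` is free of `l`, as AM-GM permits. The value `0` for inadmissible
    -- `y` makes `r y` tend to zero for every `y`.
    · refine ⟨fun l => (1 + ∑ i, l i) ^ (2 * (d + 2)) + (1 + ∑ i, l i) ^ 8,
        fun y m => if (∀ i, 0 < y i) ∧ ∑ i, y i < 1 then
          (((K y) ^ 2 + (K y * Jᶜ.card) ^ 2) * (m : ℝ)⁻¹ + K y * Jᶜ.card * (√√(m : ℝ))⁻¹)
            + K y * |scaledCollision y m - gaussianFactor y| else 0, fun l hl => ?_,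
        fun y m => ?_, fun y => ?_, fun h => absurd h hJ, fun l y m hl hm hy => ?_⟩
      · have : 0 ≤ ∑ i, l i := Finset.sum_nonneg fun i _ => hl i
        positivity
      · have := hK0 y
        dsimp only
        split_ifs <;> positivity
      · by_cases hy : (∀ i, 0 < y i) ∧ ∑ i, y i < 1
        · simp only [if_pos hy]
          have h1 : Filter.Tendsto (fun m : ℕ => (m : ℝ)⁻¹) Filter.atTop (nhds 0) :=
            tendsto_inv_atTop_nhds_zero_nat
          have h2 : Filter.Tendsto (fun m : ℕ => (√√(m : ℝ))⁻¹) Filter.atTop (nhds 0) :=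
            (Real.tendsto_sqrt_atTop.comp (Real.tendsto_sqrt_atTop.comp
              tendsto_natCast_atTop_atTop)).inv_tendsto_atTop
          have h3 : Filter.Tendsto (fun m => |scaledCollision y m - gaussianFactor y|)
              Filter.atTop (nhds 0) := by
            have h : Filter.Tendsto (scaledCollision y) Filter.atTop (nhds (gaussianFactor y)) :=
              tendsto_rpow_mul_integral_stepChar hy.1 hy.2
            simpa only [sub_self, abs_zero] using (h.sub_const (gaussianFactor y)).abs
          simpa only [mul_zero, add_zero] using ((h1.const_mul _).add (h2.const_mul _)).add
            (h3.const_mul (K y))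
        · simp only [if_neg hy]
          exact tendsto_const_nhds
      · have hl0 : 0 ≤ ∑ i, l i := Finset.sum_nonneg fun i _ => hl i
        simp only [if_pos hy]
        have := mul_add_div_sqrt_le (p := d + 2) (hK0 y) (Nat.cast_nonneg (α := ℝ) Jᶜ.card)
          (show 1 ≤ 1 + ∑ i, l i by linarith) hm
        linarith
  obtain ⟨C, r, hC0, hr0, hr, hrJ, hbound⟩ := main
  refine ⟨C, r, hr, ?_⟩
  intro lam m n x hlam hm hn hxs hxJ hxc hxsum Ω _ P _ X hX hlaw
  have hm0 : (0 : ℝ) < m := by exact_mod_cast hm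
  have hmx : ∀ i : ↥J, m * x i = lam i := fun i => by rw [hxJ i]; field_simp
  have hy : (∀ i : ↥Jᶜ, 0 < x i) ∧ ∑ i : ↥Jᶜ, x i < 1 :=
    ⟨fun i => (hxc i i.2).1, by rwa [Finset.sum_coe_sort Jᶜ x]⟩
  have hτ : m * ∑ i ∈ J, x i = ∑ i, lam i := by
    rw [← Finset.sum_coe_sort J x, Finset.mul_sum]
    exact Finset.sum_congr rfl fun i _ => hmx i
  have hE := hK (fun i => x i) hy m hm x hxs fun _ => rfl
  rw [hτ] at hE
  simp only [hmx] at hE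
  -- `e₁` is the total error truncated at level `C lam / m`, and `e₂` is the excess; the latter
  -- vanishes when `J` is everything, since `r` is then zero.
  obtain ⟨e₁, e₂, h₁, h₂, h₁₂⟩ := exists_eq_add_of_abs_le_add
    (mul_nonneg (hC0 lam hlam) (inv_nonneg.2 hm0.le)) (hr0 (fun i => x i) m)
    (hE.trans (hbound lam (fun i => x i) m hlam hm hy))
  refine ⟨e₁, e₂, h₁, h₂, ?_⟩
  rw [variance_densityEstimator hf hm hn x P X hX hlaw, mul_assoc, mul_assoc,
    ← rpow_mul_scaledVariance J hm, psi_eq_gaussianFactor]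
  congr 2
  have he₂ : (if J ≠ Finset.univ then e₂ else 0) = e₂ := by
    split_ifs with h
    · rfl
    · rw [hrJ (not_not.1 h)] at h₂
      exact (abs_nonpos_iff.1 h₂).symm
  rw [he₂]
  linarith
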